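/- All manifolds are smooth, finite-dimensional, Hausdorff, second countable and without boundary; vector bundles have finite rank. **Simple quotients.** Let $E\to M$ be a vector bundle. A simple quotient of $E$ is a vector bundle morphism $q:E\to\tilde E$ over a surjective submersion $q_M:M\to\tilde M$ with connected fibers such that $q$ is fiberwise surjective. Its components are $(q_M,K,\Delta)$, where $K_x=\mathrm{Ker}(q|_{E_x})$ and, for $q_M(x)=q_M(y)$, $\Delta_{x,y}:E_y/K_y\to E_x/K_x$ is the isomorphism obtained by identifying both sides with $\tilde E_{q_M(x)}$ via $q$. A section $e\in\Gamma(E)$ is $q$-invariant if $\Delta_{y,x}(e_x \bmod K_x)=e_y \bmod K_y$ whenever $q_M(x)=q_M(y)$. If $A$ is a Lie algebroid structure on $E$ with anchor $\rho$, then $q$ is a simple quotient of $A$ if $\tilde E$ has a (necessarily unique) Lie algebroid structure $\tilde A=q_*A$, with anchor $\tilde\rho$, for which $q:A\to\tilde A$ is a Lie algebroid morphism. **IM 2-forms.** A pair of vector bundle morphisms $\mu:E\to T^*M$, $\eta:E\to\Lambda^2T^*M$ (the components of a linear 2-form on $E$) is an IM 2-form on $A$ if for all $e_1,e_2\in\Gamma(E)$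 $$i_{\rho(e_1)}\mu(e_2)=-i_{\rho(e_2)}\mu(e_1),$$ $$\mu([e_1,e_2])=L_{\rho(e_1)}\mu(e_2)-i_{\rho(e_2)}d\mu(e_1)-i_{\rho(e_2)}\eta(e_1),$$ $$\eta([e_1,e_2])=L_{\rho(e_1)}\eta(e_2)-i_{\rho(e_2)}d\eta(e_1).$$ It is $\chi$-twisted, for a closed 3-form $\chi$ on $M$, if $\eta=\eta_\chi$, where $\eta_\chi(e):=-i_{\rho(e)}\chi$; it is twisted if it is $\chi$-twisted for some closed $\chi$; it is weakly non-degenerate if $\mathrm{rk}\,E=\dim M$ and $\mathrm{Ker}\,\mu\cap\mathrm{Ker}\,\rho=0$. It is $q$-basic if $K\subset\mathrm{Ker}\,\mu\cap\mathrm{Ker}\,\eta$ and, for every $q$-invariant section $e$, the forms $\mu(e)$ and $\eta(e)$ are $q_M$-basic (pullbacks along $q_M$ of forms on $\tilde M$). In this case its quotient $(\tilde\mu,\tilde\eta)$ on $\tilde E$ is determined by $q_M^*(\tilde\mu(q(e)))=\mu(e)$ and $q_M^*(\tilde\eta(q(e)))=\eta(e)$ for all $e\in E$. **Dirac quotient data.**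 $(A,\mu,\eta,q)$ is Dirac quotient data if $q$ is a simple quotient of $A$, $(\mu,\eta)$ is a twisted IM 2-form on $A$ which is $q$-basic, and $(\tilde\mu,\tilde\eta)$ is a weakly non-degenerate twisted IM 2-form on $\tilde A$. **Statement.** Let $A$ be a Lie algebroid on $E\to M$, $q$ a simple quotient of $A$ with components $(q_M:M\to\tilde M,K,\Delta)$, and $(\mu,\eta)$ an IM 2-form on $A$. Then $(A,\mu,\eta,q)$ is Dirac quotient data if and only if the following three conditions hold: 1. there is a closed 3-form $\tilde\chi$ on $\tilde M$ such that $\eta=\eta_{q_M^*\tilde\chi}$; 2. $K=\mathrm{Ker}\,\mu\cap\rho^{-1}(\mathrm{Ker}\,Tq_M)$ and $\mathrm{rk}\,K=\mathrm{rk}\,E-\dim\tilde M$; 3. $\mathrm{Im}\,\mu\subset\mathrm{Ann}(\mathrm{Ker}\,Tq_M)$, $K\subset\mathrm{Ker}\,\mu$ (which is also part of 2), and the induced map $\bar\mu:E/K\to\mathrm{Ann}(\mathrm{Ker}\,Tq_M)$ is equivariant: $\bar\mu\circ\Delta_{x,y}=\Delta^{\nu^*}_{x,y}\circ\bar\mu$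 whenever $q_M(x)=q_M(y)$, where $\Delta^{\nu^*}_{x,y}$ sends $(T_yq_M)^*\beta$ to $(T_xq_M)^*\beta$ for $\beta\in T^*_{q_M(x)}\tilde M$. Moreover, if $(A,\mu,\eta,q)$ is Dirac quotient data and $\tilde\chi$ is any closed 3-form on $\tilde M$ as in 1, then $$\tilde L=\{(Tq_M(\rho(e)),\beta)\in T\tilde M\oplus T^*\tilde M : e\in E,\ q_M^*\beta=\mu(e)\}$$ is a $\tilde\chi$-twisted Dirac structure on $\tilde M$, that is, a subbundle of $T\tilde M\oplus T^*\tilde M$ which is Lagrangian for $\langle(X,\alpha),(Y,\beta)\rangle=\alpha(Y)+\beta(X)$ and involutive for the bracket $$[\![(X,\alpha),(Y,\beta)]\!]=([X,Y],\,L_X\beta-i_Yd\alpha+\tilde\chi(X,Y,\cdot));$$ the quotient $(\tilde\mu,\tilde\eta)$ is $\tilde\chi$-twisted, and $(\tilde\rho,\tilde\mu):\tilde E\to T\tilde M\oplus T^*\tilde M$ is injective on each fiber, has image $\tilde L$, and takes the bracket of $\tilde A$ to this bracket, so that $q_*A\simeq\tilde L$. -/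

import Mathlib

open Bundle
open scoped Manifold ContDiff Topology

namespace AlgebroidQuotient

noncomputable section

/-! ### Differential forms on a manifold

Manifolds are modelled on a finite-dimensional real vector space `B` (without boundary), with the
trivial model with corners `𝓘(ℝ, B)`. -/

section Forms

variable (B : Type*) [NormedAddCommGroup B] [NormedSpace ℝ B]
  {M : Type*} [TopologicalSpace M] [ChartedSpace B M]

/-- The space `Λᵏ T*ₓM` of alternating `k`-forms on the tangent space at `x`. -/
abbrev Alt (k : ℕ) (x : M) : Type _ := TangentSpace 𝓘(ℝ, B) x [⋀^Fin k]→L[ℝ] ℝ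

variable {B}

/-- Interior product `i_v α = α(v, ·, …, ·)`. -/
def contract {k : ℕ} {x : M} (v : TangentSpace 𝓘(ℝ, B) x) (α : Alt B (k + 1) x) : Alt B k x :=
  ContinuousAlternatingMap.curryLeft (E := B) α v

/-- Expression of a `k`-form in the preferred chart at `x₀`: the pullback under the inverse
chart. -/
def chartRep {k : ℕ} (w : ∀ x : M, Alt B k x) (x₀ : M) : B → B [⋀^Fin k]→L[ℝ] ℝ := fun y =>
  (w ((extChartAt 𝓘(ℝ, B) x₀).symm y)).compContinuousLinearMap
    (mfderiv 𝓘(ℝ, B) 𝓘(ℝ, B) (extChartAt 𝓘(ℝ, B) x₀).symm y)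

/-- A `k`-form is smooth if all its chart expressions are. -/
def IsSmoothForm {k : ℕ} (w : ∀ x : M, Alt B k x) : Prop :=
  ∀ x₀ : M, ContDiffOn ℝ ∞ (chartRep w x₀) (extChartAt 𝓘(ℝ, B) x₀).target

/-- The exterior derivative, computed in the preferred chart at each point. -/
def extD {k : ℕ} (w : ∀ x : M, Alt B k x) : ∀ x : M, Alt B (k + 1) x := fun x =>
  (extDeriv (chartRep w x) (extChartAt 𝓘(ℝ, B) x x)).compContinuousLinearMap
    (mfderiv 𝓘(ℝ, B) 𝓘(ℝ, B) (extChartAt 𝓘(ℝ, B) x) x)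

/-- The Lie derivative of a form of positive degree along a vector field, `L_X = i_X d + d i_X`. -/
def lieDer {k : ℕ} (X : ∀ x : M, TangentSpace 𝓘(ℝ, B) x) (w : ∀ x : M, Alt B (k + 1) x) :
    ∀ x : M, Alt B (k + 1) x := fun x =>
  contract (X x) (extD w x) + extD (fun z => contract (X z) (w z)) x

/-- The derivative `L_v f` of a function along a tangent vector. -/
def dirDeriv {x : M} (v : TangentSpace 𝓘(ℝ, B) x) (f : M → ℝ) : ℝ :=
  mfderiv 𝓘(ℝ, B) 𝓘(ℝ, ℝ) f x v

/-- Smooth closed forms. -/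
def IsClosedForm {k : ℕ} (w : ∀ x : M, Alt B k x) : Prop :=
  IsSmoothForm w ∧ ∀ x, extD w x = 0

variable {B' : Type*} [NormedAddCommGroup B'] [NormedSpace ℝ B']
  {M' : Type*} [TopologicalSpace M'] [ChartedSpace B' M']

/-- Pullback under the tangent map of `f` at `x`, as a linear map
`Λᵏ T*_{f x} M' → Λᵏ T*ₓ M`. -/
def pullAt (f : M → M') (k : ℕ) (x : M) : Alt B' k (f x) →ₗ[ℝ] Alt B k x where
  toFun α := α.compContinuousLinearMap (mfderiv 𝓘(ℝ, B) 𝓘(ℝ, B') f x)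
  map_add' _ _ := rfl
  map_smul' _ _ := rfl

/-- Pullback of a differential form. -/
def pullForm {k : ℕ} (f : M → M') (w : ∀ y : M', Alt B' k y) : ∀ x : M, Alt B k x :=
  fun x => pullAt f k x (w (f x))

/-- A form is `f`-basic if it is the pullback of a smooth form along `f`. -/
def IsBasicForm {k : ℕ} (f : M → M') (w : ∀ x : M, Alt B k x) : Prop :=
  ∃ w' : ∀ y : M', Alt B' k y, IsSmoothForm w' ∧ w = pullForm f w'

end Forms

/-! ### Twisted Dirac structures -/

section Dirac

variable {B : Type*} [NormedAddCommGroup B] [NormedSpace ℝ B]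
  {M : Type*} [TopologicalSpace M] [ChartedSpace B M]

/-- The symmetric pairing `⟨(X, α), (Y, β)⟩ = α(Y) + β(X)` on `TₓM ⊕ T*ₓM`. -/
def pairing {x : M} (p r : TangentSpace 𝓘(ℝ, B) x × Alt B 1 x) : ℝ :=
  p.2 (fun _ => r.1) + r.2 (fun _ => p.1)

/-- The `χ`-twisted Courant bracket
`([X, Y], L_X β - i_Y dα + χ(X, Y, ·))` of `(X, α)` and `(Y, β)`. -/
def courant (χ : ∀ x : M, Alt B 3 x)
    (X : ∀ x : M, TangentSpace 𝓘(ℝ, B) x) (α : ∀ x : M, Alt B 1 x)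
    (Y : ∀ x : M, TangentSpace 𝓘(ℝ, B) x) (β : ∀ x : M, Alt B 1 x) :
    ∀ x : M, TangentSpace 𝓘(ℝ, B) x × Alt B 1 x := fun x =>
  (VectorField.mlieBracket 𝓘(ℝ, B) X Y x,
    lieDer X β x - contract (Y x) (extD α x) + contract (Y x) (contract (X x) (χ x)))

/-- `L` is a `χ`-twisted Dirac structure: a smooth subbundle of `TM ⊕ T*M` which is Lagrangian and
involutive for the `χ`-twisted Courant bracket. (Local frames and local sections are given by global
ones, which is no restriction on a Hausdorff finite-dimensional manifold.) -/
structure IsDirac [IsManifold 𝓘(ℝ, B) ∞ M] (χ : ∀ x : M, Alt B 3 x)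
    (L : ∀ x : M, Submodule ℝ (TangentSpace 𝓘(ℝ, B) x × Alt B 1 x)) : Prop where
  subbundle : ∀ x₀ : M, ∃ (n : ℕ)
    (X : Fin n → Cₛ^∞⟮𝓘(ℝ, B); B, fun x : M => TangentSpace 𝓘(ℝ, B) x⟯)
    (α : Fin n → ∀ x : M, Alt B 1 x), (∀ i, IsSmoothForm (α i)) ∧
      ∀ᶠ x in 𝓝 x₀, LinearIndependent ℝ (fun i => (X i x, α i x)) ∧
        Submodule.span ℝ (Set.range fun i => (X i x, α i x)) = L x
  lagrangian : ∀ (x : M) (p : TangentSpace 𝓘(ℝ, B) x × Alt B 1 x),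
    p ∈ L x ↔ ∀ r ∈ L x, pairing p r = 0
  involutive : ∀ (X Y : Cₛ^∞⟮𝓘(ℝ, B); B, fun x : M => TangentSpace 𝓘(ℝ, B) x⟯)
    (α β : ∀ x : M, Alt B 1 x), IsSmoothForm α → IsSmoothForm β →
    (∀ x, (X x, α x) ∈ L x) → (∀ x, (Y x, β x) ∈ L x) → ∀ x, courant χ X α Y β x ∈ L x

end Dirac

/-! ### Lie algebroids and IM 2-forms -/

section Algebroid

variable (B : Type*) [NormedAddCommGroup B] [NormedSpace ℝ B]
  {M : Type*} [TopologicalSpace M] [ChartedSpace B M] [IsManifold 𝓘(ℝ, B) ∞ M]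
  (F : Type*) [NormedAddCommGroup F] [NormedSpace ℝ F]
  (E : M → Type*) [TopologicalSpace (TotalSpace F E)] [∀ x, AddCommGroup (E x)]
  [∀ x, Module ℝ (E x)] [∀ x, TopologicalSpace (E x)] [FiberBundle F E] [VectorBundle ℝ F E]

/-- Smooth global sections of the vector bundle `E → M`. -/
abbrev Sec : Type _ := Cₛ^∞⟮𝓘(ℝ, B); F, E⟯

variable {B F E} in
/-- The product of a smooth function and a smooth section. -/
def smulSec (f : C^∞⟮𝓘(ℝ, B), M; ℝ⟯) (s : Sec B F E) : Sec B F E :=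
  ⟨fun x => f x • s x, f.contMDiff.smul_section s.contMDiff⟩

/-- A Lie algebroid structure on the vector bundle `E → M`. -/
structure LieAlgebroid where
  /-- the anchor `ρ : E → TM` -/
  anchor : ∀ x, E x →ₗ[ℝ] TangentSpace 𝓘(ℝ, B) x
  anchor_smooth : ContMDiff (𝓘(ℝ, B).prod 𝓘(ℝ, F)) (𝓘(ℝ, B).prod 𝓘(ℝ, B)) ∞
    (fun p : TotalSpace F E => (⟨p.proj, anchor p.proj p.2⟩ : TangentBundle 𝓘(ℝ, B) M))
  /-- the Lie bracket on sections -/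
  bracket : Sec B F E →ₗ[ℝ] Sec B F E →ₗ[ℝ] Sec B F E
  bracket_self : ∀ s, bracket s s = 0
  jacobi : ∀ s t u, bracket s (bracket t u) = bracket (bracket s t) u + bracket t (bracket s u)
  leibniz : ∀ (s t : Sec B F E) (f : C^∞⟮𝓘(ℝ, B), M; ℝ⟯) (x : M),
    bracket s (smulSec f t) x = f x • bracket s t x + dirDeriv (anchor x (s x)) f • t x

/-- A smooth vector bundle morphism `E → Λᵏ T*M` over the identity: a family of linear maps on the
fibers which takes smooth sections to smooth forms. -/
structure FormMap (k : ℕ) where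
  /-- the linear map on the fiber over `x` -/
  toLin : ∀ x : M, E x →ₗ[ℝ] Alt B k x
  smooth : ∀ s : Sec B F E, IsSmoothForm (fun x => toLin x (s x))

variable {B F E}

/-- The differential form `μ(s)` obtained from a section `s`. -/
def FormMap.onSec {k : ℕ} (μ : FormMap B F E k) (s : Sec B F E) : ∀ x : M, Alt B k x :=
  fun x => μ.toLin x (s x)

/-- The vector field `ρ(s)`. -/
def LieAlgebroid.anchorSec (A : LieAlgebroid B F E) (s : Sec B F E) :
    ∀ x : M, TangentSpace 𝓘(ℝ, B) x :=
  fun x => A.anchor x (s x)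

/-- The pair `(μ, η)`, with `μ : E → T*M` and `η : E → Λ²T*M`, is an IM 2-form on `A`. -/
structure IsIM (A : LieAlgebroid B F E) (μ : FormMap B F E 1) (η : FormMap B F E 2) : Prop where
  skew : ∀ (s t : Sec B F E) (x : M),
    contract (A.anchorSec s x) (μ.onSec t x) = -contract (A.anchorSec t x) (μ.onSec s x)
  bracket_mu : ∀ (s t : Sec B F E) (x : M),
    μ.onSec (A.bracket s t) x = lieDer (A.anchorSec s) (μ.onSec t) x
      - contract (A.anchorSec t x) (extD (μ.onSec s) x)
      - contract (A.anchorSec t x) (η.onSec s x)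
  bracket_eta : ∀ (s t : Sec B F E) (x : M),
    η.onSec (A.bracket s t) x = lieDer (A.anchorSec s) (η.onSec t) x
      - contract (A.anchorSec t x) (extD (η.onSec s) x)

/-- `η = η_χ`, where `η_χ(e) = -i_{ρ(e)} χ`. -/
def IsTwistedBy (A : LieAlgebroid B F E) (η : FormMap B F E 2) (χ : ∀ x : M, Alt B 3 x) : Prop :=
  ∀ (x : M) (e : E x), η.toLin x e = -contract (A.anchor x e) (χ x)

/-- Weak non-degeneracy: `rk E = dim M` and `Ker μ ∩ Ker ρ = 0`. -/
def IsWeaklyNondegenerate (A : LieAlgebroid B F E) (μ : FormMap B F E 1) : Prop :=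
  ∀ x : M, Module.finrank ℝ (E x) = Module.finrank ℝ B ∧
    LinearMap.ker (μ.toLin x) ⊓ LinearMap.ker (A.anchor x) = ⊥

end Algebroid

/-! ### Simple quotients -/

section Quotient

variable
  (B : Type*) [NormedAddCommGroup B] [NormedSpace ℝ B]
  {M : Type*} [TopologicalSpace M] [ChartedSpace B M]
  (F : Type*) [NormedAddCommGroup F] [NormedSpace ℝ F]
  (E : M → Type*) [TopologicalSpace (TotalSpace F E)] [∀ x, AddCommGroup (E x)]
  [∀ x, Module ℝ (E x)] [∀ x, TopologicalSpace (E x)] [FiberBundle F E]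
  (B' : Type*) [NormedAddCommGroup B'] [NormedSpace ℝ B']
  {M' : Type*} [TopologicalSpace M'] [ChartedSpace B' M']
  (F' : Type*) [NormedAddCommGroup F'] [NormedSpace ℝ F']
  (E' : M' → Type*) [TopologicalSpace (TotalSpace F' E')] [∀ y, AddCommGroup (E' y)]
  [∀ y, Module ℝ (E' y)] [∀ y, TopologicalSpace (E' y)] [FiberBundle F' E']

/-- A simple quotient `(q, q_M)` of the vector bundle `E → M` onto `E' → M'`. -/
structure SimpleQuotient where
  /-- the base map `q_M : M → M'` -/
  base : M → M'
  base_smooth : ContMDiff 𝓘(ℝ, B) 𝓘(ℝ, B') ∞ base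
  base_surjective : Function.Surjective base
  base_submersion : ∀ x, Function.Surjective (mfderiv 𝓘(ℝ, B) 𝓘(ℝ, B') base x)
  fiber_connected : ∀ y : M', IsConnected (base ⁻¹' {y})
  /-- the bundle map `q` on the fiber over `x` -/
  map : ∀ x, E x →ₗ[ℝ] E' (base x)
  map_smooth : ContMDiff (𝓘(ℝ, B).prod 𝓘(ℝ, F)) (𝓘(ℝ, B').prod 𝓘(ℝ, F')) ∞
    (fun p : TotalSpace F E => (⟨base p.proj, map p.proj p.2⟩ : TotalSpace F' E'))
  map_surjective : ∀ x, Function.Surjective (map x)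

variable {B F E B' F' E'}

namespace SimpleQuotient

variable (q : SimpleQuotient B F E B' F' E')

/-- The component `K = Ker q ⊆ E`. -/
def K (x : M) : Submodule ℝ (E x) := LinearMap.ker (q.map x)

/-- The isomorphism `E_x / K_x ≃ E'_{q_M(x)}` induced by `q`. -/
def fiberIso (x : M) : (E x ⧸ q.K x) ≃ₗ[ℝ] E' (q.base x) :=
  (q.map x).quotKerEquivOfSurjective (q.map_surjective x)

/-- Identification of the fibers over equal points. -/
def castFiber {N : Type*} (V : N → Type*) [∀ y, AddCommGroup (V y)] [∀ y, Module ℝ (V y)]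
    {y z : N} (h : y = z) : V y ≃ₗ[ℝ] V z :=
  h ▸ LinearEquiv.refl ℝ (V y)

/-- The component `Δ_{x,y} : E_y / K_y ≃ E_x / K_x`, defined whenever `q_M(x) = q_M(y)`. -/
def Δ (x y : M) (h : q.base x = q.base y) : (E y ⧸ q.K y) ≃ₗ[ℝ] (E x ⧸ q.K x) :=
  (q.fiberIso y).trans ((castFiber E' h.symm).trans (q.fiberIso x).symm)

/-- The annihilator `Ann(Ker T_x q_M) ⊆ T*ₓM`. -/
def ann (x : M) : Submodule ℝ (Alt B 1 x) where
  carrier := {α | ∀ v : TangentSpace 𝓘(ℝ, B) x,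
    mfderiv 𝓘(ℝ, B) 𝓘(ℝ, B') q.base x v = 0 → α (fun _ => v) = 0}
  add_mem' := by
    intro a b ha hb v hv
    simp [ha v hv, hb v hv]
  zero_mem' := by
    intro v _
    simp
  smul_mem' := by
    intro c a ha v hv
    simp [ha v hv]

theorem pullAt_mem_ann (x : M) (β : Alt B' 1 (q.base x)) : pullAt q.base 1 x β ∈ q.ann x := by
  intro v hv
  have h0 : pullAt q.base 1 x β (fun _ => v)
      = β (fun _ => mfderiv 𝓘(ℝ, B) 𝓘(ℝ, B') q.base x v) := rfl
  rw [h0, hv]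
  exact β.map_coord_zero 0 rfl

theorem exists_rightInverse {V W : Type*} [NormedAddCommGroup V] [NormedSpace ℝ V]
    [NormedAddCommGroup W] [NormedSpace ℝ W] [FiniteDimensional ℝ W] (f : V →L[ℝ] W)
    (hf : Function.Surjective f) : ∃ g : W →L[ℝ] V, ∀ w, f (g w) = w := by
  obtain ⟨g, hg⟩ := LinearMap.exists_rightInverse_of_surjective f.toLinearMap
    (LinearMap.range_eq_top.2 hf)
  exact ⟨g.toContinuousLinearMap, fun w => LinearMap.congr_fun hg w⟩

theorem pullAt_ann_bijective [FiniteDimensional ℝ B'] (x : M) :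
    Function.Bijective ((pullAt q.base 1 x).codRestrict (q.ann x) (q.pullAt_mem_ann x)) := by
  constructor
  · intro β γ h
    have h' : pullAt q.base 1 x β = pullAt q.base 1 x γ := congrArg Subtype.val h
    ext v
    choose u hu using fun i => q.base_submersion x (v i)
    have h2 := DFunLike.congr_fun h' u
    have h3 : β (fun i => mfderiv 𝓘(ℝ, B) 𝓘(ℝ, B') q.base x (u i))
        = γ (fun i => mfderiv 𝓘(ℝ, B) 𝓘(ℝ, B') q.base x (u i)) := h2
    rwa [funext hu] at h3
  · rintro ⟨α, hα⟩
    obtain ⟨g', hg⟩ := exists_rightInverse (V := B) (W := B')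
      (mfderiv 𝓘(ℝ, B) 𝓘(ℝ, B') q.base x : B →L[ℝ] B') (q.base_submersion x)
    let g : TangentSpace 𝓘(ℝ, B') (q.base x) →L[ℝ] TangentSpace 𝓘(ℝ, B) x := g'
    refine ⟨α.compContinuousLinearMap g, Subtype.ext ?_⟩
    ext v
    have hv : v = fun _ => v 0 := by
      funext i
      rw [Subsingleton.elim i 0]
    have key : α (fun _ => g (mfderiv 𝓘(ℝ, B) 𝓘(ℝ, B') q.base x (v 0)) - v 0) = 0 := by
      apply hα
      rw [map_sub]
      exact sub_eq_zero.2 (hg (mfderiv 𝓘(ℝ, B) 𝓘(ℝ, B') q.base x (v 0)))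
    have hsub : ∀ a b : TangentSpace 𝓘(ℝ, B) x,
        α (fun _ => a - b) = α (fun _ => a) - α (fun _ => b) := by
      intro a b
      have h := α.toMultilinearMap.map_update_sub (fun _ => (0 : TangentSpace 𝓘(ℝ, B) x)) 0 a b
      have hu : ∀ c : TangentSpace 𝓘(ℝ, B) x,
          Function.update (fun _ : Fin 1 => (0 : TangentSpace 𝓘(ℝ, B) x)) 0 c = fun _ => c := by
        intro c
        funext i
        rw [Subsingleton.elim i 0, Function.update_self]
      rw [hu, hu, hu] at h
      exact h
    rw [hsub] at key
    rw [hv]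
    exact sub_eq_zero.1 key

/-- The isomorphism `T*_{q_M(x)} M' ≃ Ann(Ker T_x q_M)`, `β ↦ q_M^* β`. -/
def conormalIso [FiniteDimensional ℝ B'] (x : M) : Alt B' 1 (q.base x) ≃ₗ[ℝ] q.ann x :=
  LinearEquiv.ofBijective _ (q.pullAt_ann_bijective x)

/-- The representation `Δ^{ν*}_{x,y} : Ann(Ker T_y q_M) ≃ Ann(Ker T_x q_M)` for
`q_M(x) = q_M(y)`, which sends `q_M^* β` at `y` to `q_M^* β` at `x`. -/
def conormalΔ [FiniteDimensional ℝ B'] (x y : M) (h : q.base x = q.base y) :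
    q.ann y ≃ₗ[ℝ] q.ann x :=
  (q.conormalIso y).symm.trans
    ((castFiber (fun z : M' => Alt B' 1 z) h.symm).trans (q.conormalIso x))

end SimpleQuotient

variable (q : SimpleQuotient B F E B' F' E')

/-- `q`-invariant sections of `E`. -/
def SimpleQuotient.IsInvariant (s : Sec B F E) : Prop :=
  ∀ (x y : M) (h : q.base x = q.base y),
    q.Δ y x h.symm ((q.K x).mkQ (s x)) = (q.K y).mkQ (s y)

variable [IsManifold 𝓘(ℝ, B) ∞ M] [VectorBundle ℝ F E] [IsManifold 𝓘(ℝ, B') ∞ M']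
  [VectorBundle ℝ F' E']

/-- `q` is a Lie algebroid morphism `A → A'`: it is compatible with the anchors, and if
`q ∘ a = ∑ᵢ uᵢ (aᵢ ∘ q_M)` and `q ∘ b = ∑ⱼ vⱼ (bⱼ ∘ q_M)` then
`q ∘ [a, b] = ∑ᵢⱼ uᵢ vⱼ ([aᵢ, bⱼ] ∘ q_M) + ∑ⱼ (L_{ρ(a)} vⱼ) (bⱼ ∘ q_M) - ∑ᵢ (L_{ρ(b)} uᵢ) (aᵢ ∘ q_M)`.
When such an `A'` exists, `A` is `q`-basic, `A'` is its quotient `q_* A`, and `q` is said to define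
a simple quotient of `A`. -/
structure SimpleQuotient.IsAlgebroidMorphism (A : LieAlgebroid B F E)
    (A' : LieAlgebroid B' F' E') : Prop where
  anchor : ∀ (x : M) (e : E x), A'.anchor (q.base x) (q.map x e) =
    mfderiv 𝓘(ℝ, B) 𝓘(ℝ, B') q.base x (A.anchor x e)
  bracket : ∀ (a b : Sec B F E) (m n : ℕ)
    (u : Fin m → C^∞⟮𝓘(ℝ, B), M; ℝ⟯) (a' : Fin m → Sec B' F' E')
    (v : Fin n → C^∞⟮𝓘(ℝ, B), M; ℝ⟯) (b' : Fin n → Sec B' F' E'),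
    (∀ x, q.map x (a x) = ∑ i, u i x • a' i (q.base x)) →
    (∀ x, q.map x (b x) = ∑ j, v j x • b' j (q.base x)) →
    ∀ x, q.map x (A.bracket a b x) =
      (∑ i, ∑ j, (u i x * v j x) • A'.bracket (a' i) (b' j) (q.base x))
      + (∑ j, dirDeriv (A.anchor x (a x)) (v j) • b' j (q.base x))
      - ∑ i, dirDeriv (A.anchor x (b x)) (u i) • a' i (q.base x)

/-- The pair `(μ, η)` is `q`-basic: `μ` and `η` vanish on `K`, and they take `q`-invariant
sections to `q_M`-basic forms. -/
structure SimpleQuotient.IsBasicPair (μ : FormMap B F E 1) (η : FormMap B F E 2) : Prop where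
  mu_K : ∀ x, q.K x ≤ LinearMap.ker (μ.toLin x)
  eta_K : ∀ x, q.K x ≤ LinearMap.ker (η.toLin x)
  mu_basic : ∀ s, q.IsInvariant s → IsBasicForm (B' := B') q.base (μ.onSec s)
  eta_basic : ∀ s, q.IsInvariant s → IsBasicForm (B' := B') q.base (η.onSec s)

/-- `μ'` is the quotient `q_* μ`: `q_M^* (μ'(q(e))) = μ(e)` for all `e ∈ E`. -/
def SimpleQuotient.IsPushforward {k : ℕ} (μ : FormMap B F E k) (μ' : FormMap B' F' E' k) : Prop :=
  ∀ (x : M) (e : E x), pullAt q.base k x (μ'.toLin (q.base x) (q.map x e)) = μ.toLin x e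

/-- `(A, μ, η, q)` is Dirac quotient data, where `A' = q_* A`: the pair `(μ, η)` is a twisted IM
2-form on `A`, it is `q`-basic, and its quotient is a weakly non-degenerate twisted IM 2-form on
`A'`. -/
structure IsDiracQuotientData (A : LieAlgebroid B F E) (A' : LieAlgebroid B' F' E')
    (μ : FormMap B F E 1) (η : FormMap B F E 2) : Prop where
  isIM : IsIM A μ η
  twisted : ∃ χ : ∀ x : M, Alt B 3 x, IsClosedForm χ ∧ IsTwistedBy A η χ
  basic : q.IsBasicPair μ η
  quotient : ∃ (μ' : FormMap B' F' E' 1) (η' : FormMap B' F' E' 2),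
    q.IsPushforward μ μ' ∧ q.IsPushforward η η' ∧ IsIM A' μ' η' ∧
    (∃ χ' : ∀ y : M', Alt B' 3 y, IsClosedForm χ' ∧ IsTwistedBy A' η' χ') ∧
    IsWeaklyNondegenerate A' μ'

/-- The induced map `μ̄ : E_x / K_x → Ann(Ker T_x q_M)`. -/
def SimpleQuotient.muBar (μ : FormMap B F E 1) (hK : ∀ x, q.K x ≤ LinearMap.ker (μ.toLin x))
    (hAnn : ∀ x (e : E x), μ.toLin x e ∈ q.ann x) (x : M) : (E x ⧸ q.K x) →ₗ[ℝ] q.ann x :=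
  LinearMap.codRestrict (q.ann x) ((q.K x).liftQ (μ.toLin x) (hK x)) fun e => by
    obtain ⟨e, rfl⟩ := (q.K x).mkQ_surjective e
    exact hAnn x e

/-- The elements `(Tq_M(ρ(e)), β)`, with `e ∈ E` and `q_M^* β = μ(e)`, of the quotient
`L' ⊆ TM' ⊕ T*M'`. -/
inductive SimpleQuotient.MemReduced (A : LieAlgebroid B F E) (μ : FormMap B F E 1) :
    ∀ y : M', TangentSpace 𝓘(ℝ, B') y × Alt B' 1 y → Prop
  | mk (x : M) (e : E x) (β : Alt B' 1 (q.base x)) (h : pullAt q.base 1 x β = μ.toLin x e) :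
    SimpleQuotient.MemReduced A μ (q.base x)
      (mfderiv 𝓘(ℝ, B) 𝓘(ℝ, B') q.base x (A.anchor x e), β)

end Quotient

end

end AlgebroidQuotient

open AlgebroidQuotient

namespace AlgebroidQuotient

/-! ### Smoothness of families of alternating forms -/

section AlternatingForms

variable {X B B' : Type*} [NormedAddCommGroup X] [NormedSpace ℝ X]
  [NormedAddCommGroup B] [NormedSpace ℝ B] [FiniteDimensional ℝ B]
  [NormedAddCommGroup B'] [NormedSpace ℝ B'] {k : ℕ} {n : ℕ∞ω}

/-! Since `q.base` is a submersion, pullback of forms along it is injective at each point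
(`pullAt_injective`), and a form downstairs is smooth as soon as its pullback is
(`smoothFormAt_of_pullForm`, by means of local sections). Thus every question about the quotient can
be settled on `M`.

Being Dirac quotient data amounts to the existence of pushforwards `μ'`, `η'` with the right
properties. Equivariance of `μ̄` is what makes `μ'` independent of the point chosen in each fiber of
`q.base` (`exists_isPushforward_of_equivariant`). Condition 1 supplies `η' = η_χ'`, since `q`
intertwines the anchors. The IM equations descend (`IsIM.of_isPushforward`): sections of `E'` lift
locally to `E`, the lifts have related anchors and brackets, and `i`, `d`, `L` commute with
pullback. Condition 2 is weak non-degeneracy downstairs, because `Ker μ ∩ ρ⁻¹(Ker Tq_M)` is the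
preimage under `q` of `Ker μ' ∩ Ker ρ'` (`isWeaklyNondegenerate_iff`).

For the Dirac structure, weak non-degeneracy makes `(ρ', μ')` injective with image of rank `dim M'`.
The image is isotropic by the skewness equation, hence Lagrangian by dimension. The `μ`-equation,
together with the fact that an anchor preserves brackets (`anchor_bracket`), says that `(ρ', μ')`
takes the bracket to the twisted Courant bracket (`IsIM.prod_bracket`), and smooth sections of the
image lift to smooth sections of `E'` (`exists_sec_of_mem_range`), which gives involutivity. -/

variable (B k) in
theorem finiteDimensional_continuousMultilinearMap :
    FiniteDimensional ℝ (ContinuousMultilinearMap ℝ (fun _ : Fin k => B) ℝ) :=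
  Module.Finite.of_injective
    (ContinuousMultilinearMap.toMultilinearMapLinear :
      ContinuousMultilinearMap ℝ (fun _ : Fin k => B) ℝ →ₗ[ℝ] _)
    ContinuousMultilinearMap.toMultilinearMap_injective

variable (B k) in
theorem finiteDimensional_continuousAlternatingMap :
    FiniteDimensional ℝ (B [⋀^Fin k]→L[ℝ] ℝ) :=
  have := finiteDimensional_continuousMultilinearMap B k
  Module.Finite.of_injective
    (ContinuousAlternatingMap.toContinuousMultilinearMapCLM ℝ :
      B [⋀^Fin k]→L[ℝ] ℝ →L[ℝ] _).toLinearMap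
    ContinuousAlternatingMap.toContinuousMultilinearMap_injective

/-- The inclusion of alternating into multilinear maps has a linear left inverse, which is
continuous because the spaces are finite-dimensional. -/
theorem contDiffAt_alternating_of_multilinear {w : X → B [⋀^Fin k]→L[ℝ] ℝ} {x : X}
    (h : ContDiffAt ℝ n (fun y => (w y).toContinuousMultilinearMap) x) : ContDiffAt ℝ n w x := by
  have := finiteDimensional_continuousMultilinearMap B k
  obtain ⟨p, hp⟩ := LinearMap.exists_leftInverse_of_injective
    (ContinuousAlternatingMap.toContinuousMultilinearMapCLM ℝ :
      B [⋀^Fin k]→L[ℝ] ℝ →L[ℝ] _).toLinearMap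
    (LinearMap.ker_eq_bot.2 ContinuousAlternatingMap.toContinuousMultilinearMap_injective)
  have h2 := p.toContinuousLinearMap.contDiff.contDiffAt.comp x h
  have h3 : (p.toContinuousLinearMap ∘ fun y => (w y).toContinuousMultilinearMap) = w := by
    funext y
    exact LinearMap.congr_fun hp (w y)
  rwa [h3] at h2

/-- Among multilinear maps, precomposition is linear in the form and continuous multilinear in the
tuple `(L, …, L)`, hence smooth in both. -/
theorem _root_.ContDiffAt.alternating_compContinuousLinearMap
    {w : X → B' [⋀^Fin k]→L[ℝ] ℝ} {L : X → B →L[ℝ] B'} {x : X}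
    (hw : ContDiffAt ℝ n w x) (hL : ContDiffAt ℝ n L x) :
    ContDiffAt ℝ n (fun y => (w y).compContinuousLinearMap (L y)) x := by
  apply contDiffAt_alternating_of_multilinear
  have h1 : ContDiffAt ℝ n (fun y => (w y).toContinuousMultilinearMap) x :=
    (ContinuousAlternatingMap.toContinuousMultilinearMapCLM ℝ :
      B' [⋀^Fin k]→L[ℝ] ℝ →L[ℝ] _).contDiff.contDiffAt.comp x hw
  have h2 := ContinuousMultilinearMap.contDiff (𝕜 := ℝ) (E := fun _ : Fin k => B →L[ℝ] B') (n := n)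
    (F := ContinuousMultilinearMap ℝ (fun _ : Fin k => B') ℝ →L[ℝ]
      ContinuousMultilinearMap ℝ (fun _ : Fin k => B) ℝ)
    (ContinuousMultilinearMap.compContinuousLinearMapContinuousMultilinear ℝ
      (fun _ : Fin k => B) (fun _ => B') ℝ)
  have h3 : ContDiffAt ℝ n (fun y => fun _ : Fin k => L y) x := contDiffAt_pi.2 fun _ => hL
  exact (h2.contDiffAt.comp x h3).clm_apply h1

omit [FiniteDimensional ℝ B] in
theorem contDiff_curryLeft :
    ContDiff ℝ n (fun α : B [⋀^Fin (k + 1)]→L[ℝ] ℝ => α.curryLeft) := by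
  apply IsBoundedLinearMap.contDiff
  refine ⟨⟨fun _ _ => rfl, fun _ _ => rfl⟩, 1, one_pos, fun α => ?_⟩
  simp

end AlternatingForms

/-! ### Smooth forms at a point, pullbacks and the exterior derivative -/

section Forms

variable {B : Type*} [NormedAddCommGroup B] [NormedSpace ℝ B]
  {M : Type*} [TopologicalSpace M] [ChartedSpace B M]
  {B' : Type*} [NormedAddCommGroup B'] [NormedSpace ℝ B']
  {M' : Type*} [TopologicalSpace M'] [ChartedSpace B' M'] {k : ℕ}

/-- Smoothness of a form at a point, in the preferred chart at that point. -/
def SmoothFormAt (w : ∀ x : M, Alt B k x) (x : M) : Prop :=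
  ContDiffAt ℝ ∞ (chartRep w x) (extChartAt 𝓘(ℝ, B) x x)

theorem chartRep_congr {w w' : ∀ x : M, Alt B k x} {x x₀ : M}
    (hx : x ∈ (extChartAt 𝓘(ℝ, B) x₀).source) (h : ∀ᶠ z in 𝓝 x, w z = w' z) :
    chartRep w x₀ =ᶠ[𝓝 (extChartAt 𝓘(ℝ, B) x₀ x)] chartRep w' x₀ := by
  have hc : Filter.Tendsto (extChartAt 𝓘(ℝ, B) x₀).symm (𝓝 (extChartAt 𝓘(ℝ, B) x₀ x)) (𝓝 x) := by
    have := continuousAt_extChartAt_symm' (I := 𝓘(ℝ, B)) hx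
    rwa [ContinuousAt, (extChartAt 𝓘(ℝ, B) x₀).left_inv hx] at this
  filter_upwards [hc.eventually h] with y hy
  simp only [chartRep, hy]

theorem extD_congr {w w' : ∀ x : M, Alt B k x} {x : M} (h : ∀ᶠ z in 𝓝 x, w z = w' z) :
    extD w x = extD w' x := by
  unfold extD
  rw [(chartRep_congr (mem_extChartAt_source x) h).extDeriv_eq]

theorem SmoothFormAt.congr {w w' : ∀ x : M, Alt B k x} {x : M} (hw : SmoothFormAt w x)
    (h : ∀ᶠ z in 𝓝 x, w z = w' z) : SmoothFormAt w' x :=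
  ContDiffAt.congr_of_eventuallyEq hw (chartRep_congr (mem_extChartAt_source x) h).symm

section Pullback

variable [IsManifold 𝓘(ℝ, B) ∞ M] [IsManifold 𝓘(ℝ, B') ∞ M']

/-- Coordinate expression of a map in charts centred at `x₀` and `y₀`. -/
noncomputable abbrev coordRep (B B' : Type*) [NormedAddCommGroup B] [NormedSpace ℝ B]
    [NormedAddCommGroup B'] [NormedSpace ℝ B'] {M M' : Type*} [TopologicalSpace M]
    [ChartedSpace B M] [TopologicalSpace M'] [ChartedSpace B' M'] (f : M → M') (x₀ : M) (y₀ : M') :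
    B → B' :=
  extChartAt 𝓘(ℝ, B') y₀ ∘ f ∘ (extChartAt 𝓘(ℝ, B) x₀).symm

theorem contDiffAt_coordRep {f : M → M'} {x x₀ : M} {y₀ : M'}
    (hx : x ∈ (extChartAt 𝓘(ℝ, B) x₀).source) (hy : f x ∈ (extChartAt 𝓘(ℝ, B') y₀).source)
    (hf : ContMDiffAt 𝓘(ℝ, B) 𝓘(ℝ, B') ∞ f x) :
    ContDiffAt ℝ ∞ (coordRep B B' f x₀ y₀) (extChartAt 𝓘(ℝ, B) x₀ x) := by
  rw [extChartAt_source] at hx hy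
  have := ((contMDiffAt_iff_of_mem_source hx hy).1 hf).2
  simpa only [modelWithCornersSelf_coe, Set.range_id, contDiffWithinAt_univ] using this

theorem mdifferentiableAt_extChartAt_symm {x₀ : M} {y : B}
    (hy : y ∈ (extChartAt 𝓘(ℝ, B) x₀).target) :
    MDifferentiableAt 𝓘(ℝ, B) 𝓘(ℝ, B) (extChartAt 𝓘(ℝ, B) x₀).symm y :=
  (((contMDiffOn_extChartAt_symm (I := 𝓘(ℝ, B)) (n := ∞) x₀).contMDiffAt
    ((isOpen_extChartAt_target x₀).mem_nhds hy))).mdifferentiableAt (by simp)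

/-- The chain rule applied to both sides of `ψ.symm ∘ coordRep = f ∘ φ.symm`, an identity valid only
near the point. -/
theorem chartRep_pullForm {f : M → M'} {x x₀ : M} {y₀ : M'}
    (hx : x ∈ (extChartAt 𝓘(ℝ, B) x₀).source) (hy : f x ∈ (extChartAt 𝓘(ℝ, B') y₀).source)
    (hf : ContMDiffAt 𝓘(ℝ, B) 𝓘(ℝ, B') ∞ f x) (w : ∀ y : M', Alt B' k y) :
    chartRep (pullForm (B := B) f w) x₀ =ᶠ[𝓝 (extChartAt 𝓘(ℝ, B) x₀ x)] fun z =>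
      (chartRep w y₀ (coordRep B B' f x₀ y₀ z)).compContinuousLinearMap
        (fderiv ℝ (coordRep B B' f x₀ y₀) z) := by
  have hIM : IsManifold 𝓘(ℝ, B) 1 M := IsManifold.of_le (n := ∞) (by simp)
  have hIM' : IsManifold 𝓘(ℝ, B') 1 M' := IsManifold.of_le (n := ∞) (by simp)
  have hc : Filter.Tendsto (extChartAt 𝓘(ℝ, B) x₀).symm (𝓝 (extChartAt 𝓘(ℝ, B) x₀ x)) (𝓝 x) := by
    have := continuousAt_extChartAt_symm' (I := 𝓘(ℝ, B)) hx
    rwa [ContinuousAt, (extChartAt 𝓘(ℝ, B) x₀).left_inv hx] at this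
  have hd : ∀ᶠ z in 𝓝 x, ContMDiffAt 𝓘(ℝ, B) 𝓘(ℝ, B') 1 f z :=
    (contMDiffAt_iff_contMDiffAt_nhds (by simp)).1 (hf.of_le (by simp))
  have hs : ∀ᶠ z in 𝓝 x, f z ∈ (extChartAt 𝓘(ℝ, B') y₀).source :=
    hf.continuousAt ((isOpen_extChartAt_source y₀).mem_nhds hy)
  have hg : ∀ᶠ z in 𝓝 (extChartAt 𝓘(ℝ, B) x₀ x),
      ContDiffAt ℝ 1 (coordRep B B' f x₀ y₀) z :=
    ((contDiffAt_coordRep hx hy hf).of_le (by simp)).eventually (by simp)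
  have ht : ∀ᶠ z in 𝓝 (extChartAt 𝓘(ℝ, B) x₀ x), z ∈ (extChartAt 𝓘(ℝ, B) x₀).target :=
    (isOpen_extChartAt_target x₀).mem_nhds ((extChartAt 𝓘(ℝ, B) x₀).map_source hx)
  filter_upwards [hc.eventually hd, (hc.eventually hs).eventually_nhds, hg, ht]
    with z hz1 hz2 hz3 hz4
  set φ := extChartAt 𝓘(ℝ, B) x₀
  set ψ := extChartAt 𝓘(ℝ, B') y₀
  have hz5 : ψ.symm (coordRep B B' f x₀ y₀ z) = f (φ.symm z) := ψ.left_inv hz2.self_of_nhds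
  have hcomp : mfderiv 𝓘(ℝ, B) 𝓘(ℝ, B') (f ∘ φ.symm) z
      = (mfderiv 𝓘(ℝ, B) 𝓘(ℝ, B') f (φ.symm z)).comp
        (mfderiv 𝓘(ℝ, B) 𝓘(ℝ, B) φ.symm z) :=
    mfderiv_comp z (hz1.mdifferentiableAt one_ne_zero) (mdifferentiableAt_extChartAt_symm hz4)
  have hcomp' : mfderiv 𝓘(ℝ, B) 𝓘(ℝ, B') (ψ.symm ∘ coordRep B B' f x₀ y₀) z
      = (mfderiv 𝓘(ℝ, B') 𝓘(ℝ, B') ψ.symm (coordRep B B' f x₀ y₀ z)).comp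
        (mfderiv 𝓘(ℝ, B) 𝓘(ℝ, B') (coordRep B B' f x₀ y₀) z) :=
    mfderiv_comp z (mdifferentiableAt_extChartAt_symm (ψ.map_source hz2.self_of_nhds))
      (hz3.contMDiffAt.mdifferentiableAt one_ne_zero)
  have heq : (ψ.symm ∘ coordRep B B' f x₀ y₀) =ᶠ[𝓝 z] f ∘ φ.symm :=
    hz2.mono fun u hu => ψ.left_inv hu
  have hmf := heq.mfderiv_eq (I := 𝓘(ℝ, B)) (I' := 𝓘(ℝ, B'))
  have key : ∀ v : B, (mfderiv 𝓘(ℝ, B') 𝓘(ℝ, B') ψ.symm (coordRep B B' f x₀ y₀ z) :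
        B' →L[ℝ] B') (fderiv ℝ (coordRep B B' f x₀ y₀) z v)
      = (mfderiv 𝓘(ℝ, B) 𝓘(ℝ, B') f (φ.symm z) : B →L[ℝ] B')
        ((mfderiv 𝓘(ℝ, B) 𝓘(ℝ, B) φ.symm z : B →L[ℝ] B) v) := by
    intro v
    rw [mfderiv_eq_fderiv] at hcomp'
    have h1 := DFunLike.congr_fun hcomp v
    have h2 := DFunLike.congr_fun hcomp' v
    have h3 : (mfderiv 𝓘(ℝ, B) 𝓘(ℝ, B') (ψ.symm ∘ coordRep B B' f x₀ y₀) z : B →L[ℝ] B') v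
      = (mfderiv 𝓘(ℝ, B) 𝓘(ℝ, B') (f ∘ φ.symm) z : B →L[ℝ] B') v := by
        exact congrArg (fun L : B →L[ℝ] B' => L v) hmf
    exact h2.symm.trans (h3.trans h1)
  -- Seen in the model space, the fiber type no longer depends on the base point, so the base point
  -- can be rewritten along `hz5`.
  let w' : M' → B' [⋀^Fin k]→L[ℝ] ℝ := w
  ext v
  change w' (f (φ.symm z)) (fun i => (mfderiv 𝓘(ℝ, B) 𝓘(ℝ, B') f (φ.symm z) : B →L[ℝ] B')
        ((mfderiv 𝓘(ℝ, B) 𝓘(ℝ, B) φ.symm z : B →L[ℝ] B) (v i)))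
    = w' (ψ.symm (coordRep B B' f x₀ y₀ z)) (fun i =>
      (mfderiv 𝓘(ℝ, B') 𝓘(ℝ, B') ψ.symm (coordRep B B' f x₀ y₀ z) :
        B' →L[ℝ] B') (fderiv ℝ (coordRep B B' f x₀ y₀) z (v i)))
  simp only [key, hz5]

theorem contDiffAt_chartRep_pullForm [FiniteDimensional ℝ B] {f : M → M'} {x x₀ : M} {y₀ : M'}
    (hx : x ∈ (extChartAt 𝓘(ℝ, B) x₀).source) (hy : f x ∈ (extChartAt 𝓘(ℝ, B') y₀).source)
    (hf : ContMDiffAt 𝓘(ℝ, B) 𝓘(ℝ, B') ∞ f x) {w : ∀ y : M', Alt B' k y}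
    (hw : ContDiffAt ℝ ∞ (chartRep w y₀) (extChartAt 𝓘(ℝ, B') y₀ (f x))) :
    ContDiffAt ℝ ∞ (chartRep (pullForm (B := B) f w) x₀) (extChartAt 𝓘(ℝ, B) x₀ x) := by
  refine ContDiffAt.congr_of_eventuallyEq ?_ (chartRep_pullForm hx hy hf w)
  have hg := contDiffAt_coordRep hx hy hf
  have hgx : coordRep B B' f x₀ y₀ (extChartAt 𝓘(ℝ, B) x₀ x) = extChartAt 𝓘(ℝ, B') y₀ (f x) := by
    simp only [coordRep, Function.comp_apply, (extChartAt 𝓘(ℝ, B) x₀).left_inv hx]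
  rw [← hgx] at hw
  exact (hw.comp _ hg).alternating_compContinuousLinearMap (hg.fderiv_right (by simp))

theorem SmoothFormAt.pullForm [FiniteDimensional ℝ B] {f : M → M'} {x : M}
    (hf : ContMDiffAt 𝓘(ℝ, B) 𝓘(ℝ, B') ∞ f x) {w : ∀ y : M', Alt B' k y}
    (hw : SmoothFormAt w (f x)) : SmoothFormAt (pullForm (B := B) f w) x :=
  contDiffAt_chartRep_pullForm (mem_extChartAt_source _) (mem_extChartAt_source _) hf hw

omit [IsManifold 𝓘(ℝ, B) ∞ M] in
theorem pullForm_id (w : ∀ x : M, Alt B k x) : pullForm (B := B) id w = w := by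
  funext x
  have h : mfderiv 𝓘(ℝ, B) 𝓘(ℝ, B) (id : M → M) x = ContinuousLinearMap.id ℝ _ := mfderiv_id
  ext v
  change w x (fun i => mfderiv 𝓘(ℝ, B) 𝓘(ℝ, B) (id : M → M) x (v i)) = w x v
  rw [h]
  rfl

/-- Change of charts is pullback along `id`, read in the chart at `x₀` on the source and in the
preferred chart of the point on the target. -/
theorem isSmoothForm_iff [FiniteDimensional ℝ B] {w : ∀ x : M, Alt B k x} :
    IsSmoothForm w ↔ ∀ x, SmoothFormAt w x := by
  constructor
  · intro h x
    exact (h x).contDiffAt ((isOpen_extChartAt_target x).mem_nhds (mem_extChartAt_target x))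
  · intro h x₀ y hy
    have hx := (extChartAt 𝓘(ℝ, B) x₀).map_target hy
    have h1 := contDiffAt_chartRep_pullForm (f := id) (k := k) (w := w)
      (y₀ := (extChartAt 𝓘(ℝ, B) x₀).symm y) hx (mem_extChartAt_source _) contMDiffAt_id (h _)
    rw [pullForm_id, (extChartAt 𝓘(ℝ, B) x₀).right_inv hy] at h1
    exact h1.contDiffWithinAt

/-- Reduces to naturality of `extDeriv` on vector spaces: in the charts centred at `x` and `f x`,
the derivative of each chart at its centre is the identity. -/
theorem extD_pullForm {f : M → M'} {x : M} (hf : ContMDiffAt 𝓘(ℝ, B) 𝓘(ℝ, B') ∞ f x)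
    {w : ∀ y : M', Alt B' k y} (hw : SmoothFormAt w (f x)) :
    extD (pullForm (B := B) f w) x = pullAt f (k + 1) x (extD w (f x)) := by
  have hIM : IsManifold 𝓘(ℝ, B) 1 M := IsManifold.of_le (n := ∞) (by simp)
  have hIM' : IsManifold 𝓘(ℝ, B') 1 M' := IsManifold.of_le (n := ∞) (by simp)
  have hg := contDiffAt_coordRep (mem_extChartAt_source x) (mem_extChartAt_source (f x)) hf
  have hgx : coordRep B B' f x (f x) (extChartAt 𝓘(ℝ, B) x x)
      = extChartAt 𝓘(ℝ, B') (f x) (f x) := by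
    simp only [coordRep, Function.comp_apply, extChartAt_to_inv]
  have hd : DifferentiableAt ℝ (chartRep w (f x))
      (coordRep B B' f x (f x) (extChartAt 𝓘(ℝ, B) x x)) := by
    rw [hgx]
    exact ContDiffAt.differentiableAt hw (by simp)
  have h1 := extDeriv_pullback hd hg
    (by rw [minSmoothness_of_isRCLikeNormedField]; exact WithTop.coe_le_coe.2 le_top)
  have h2 : fderiv ℝ (coordRep B B' f x (f x)) (extChartAt 𝓘(ℝ, B) x x)
      = mfderiv 𝓘(ℝ, B) 𝓘(ℝ, B') f x := by
    refine Eq.trans ?_ (hf.mdifferentiableAt (by simp)).mfderiv.symm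
    rw [modelWithCornersSelf_coe, Set.range_id, fderivWithin_univ]
    rfl
  unfold extD
  rw [(chartRep_pullForm (mem_extChartAt_source x) (mem_extChartAt_source (f x)) hf w).extDeriv_eq,
    h1, hgx, h2, mfderiv_extChartAt_self, mfderiv_extChartAt_self]
  rfl

end Pullback

theorem contract_pullAt (f : M → M') (x : M) (v : TangentSpace 𝓘(ℝ, B) x)
    (α : Alt B' (k + 1) (f x)) :
    contract v (pullAt f (k + 1) x α)
      = pullAt f k x (contract (mfderiv 𝓘(ℝ, B) 𝓘(ℝ, B') f x v) α) := by
  ext u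
  change α (fun i => mfderiv 𝓘(ℝ, B) 𝓘(ℝ, B') f x (Matrix.vecCons v u i))
    = α (Matrix.vecCons (mfderiv 𝓘(ℝ, B) 𝓘(ℝ, B') f x v)
      (fun i => mfderiv 𝓘(ℝ, B) 𝓘(ℝ, B') f x (u i)))
  congr 1
  funext i
  refine Fin.cases ?_ (fun j => ?_) i <;> rfl

theorem pullAt_injective {f : M → M'} {x : M}
    (hf : Function.Surjective (mfderiv 𝓘(ℝ, B) 𝓘(ℝ, B') f x)) (k : ℕ) :
    Function.Injective (pullAt (B := B) (B' := B') f k x) := by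
  intro β γ h
  ext v
  choose u hu using fun i => hf (v i)
  have h2 : β (fun i => mfderiv 𝓘(ℝ, B) 𝓘(ℝ, B') f x (u i))
      = γ (fun i => mfderiv 𝓘(ℝ, B) 𝓘(ℝ, B') f x (u i)) := DFunLike.congr_fun h u
  rwa [funext hu] at h2

/-- Interior product of forms with vectors, as a bilinear map. -/
theorem contract_add_left {x : M} (v v' : TangentSpace 𝓘(ℝ, B) x) (α : Alt B (k + 1) x) :
    contract (v + v') α = contract v α + contract v' α :=
  map_add (ContinuousAlternatingMap.curryLeft (E := B) α) v v'

theorem contract_smul_left {x : M} (c : ℝ) (v : TangentSpace 𝓘(ℝ, B) x) (α : Alt B (k + 1) x) :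
    contract (c • v) α = c • contract v α :=
  map_smul (ContinuousAlternatingMap.curryLeft (E := B) α) c v

theorem contract_neg_right {x : M} (v : TangentSpace 𝓘(ℝ, B) x) (α : Alt B (k + 1) x) :
    contract v (-α) = -contract v α := rfl

/-- Expression of a vector field in the preferred chart at `x₀`. -/
noncomputable def vecRep (X : ∀ x : M, TangentSpace 𝓘(ℝ, B) x) (x₀ : M) : B → B := fun y =>
  (mfderiv 𝓘(ℝ, B) 𝓘(ℝ, B) (extChartAt 𝓘(ℝ, B) x₀) ((extChartAt 𝓘(ℝ, B) x₀).symm y) : B →L[ℝ] B)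
    (X ((extChartAt 𝓘(ℝ, B) x₀).symm y))

/-! ### Vector fields and interior products in charts. -/

section Contract

variable [IsManifold 𝓘(ℝ, B) ∞ M]

theorem mfderiv_extChartAt_comp_symm {x₀ : M} {y : B}
    (hy : y ∈ (extChartAt 𝓘(ℝ, B) x₀).target) (v : B) :
    (mfderiv 𝓘(ℝ, B) 𝓘(ℝ, B) (extChartAt 𝓘(ℝ, B) x₀).symm y : B →L[ℝ] B)
      ((mfderiv 𝓘(ℝ, B) 𝓘(ℝ, B) (extChartAt 𝓘(ℝ, B) x₀) ((extChartAt 𝓘(ℝ, B) x₀).symm y) :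
        B →L[ℝ] B) v) = v := by
  have hIM : IsManifold 𝓘(ℝ, B) 1 M := IsManifold.of_le (n := ∞) (by simp)
  have h := mfderivWithin_extChartAt_symm_comp_mfderiv_extChartAt (I := 𝓘(ℝ, B)) hy
  rw [modelWithCornersSelf_coe, Set.range_id, mfderivWithin_univ] at h
  exact DFunLike.congr_fun h v

/-- On fibers, the tangent trivialization at `x₀` is the derivative of the chart, so `vecRep` is the
trivialized section composed with the inverse chart. -/
theorem contDiffAt_vecRep {X : ∀ x : M, TangentSpace 𝓘(ℝ, B) x} {x₀ : M}
    (hX : ContMDiffAt 𝓘(ℝ, B) (𝓘(ℝ, B).prod 𝓘(ℝ, B)) ∞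
      (fun x => (⟨x, X x⟩ : TangentBundle 𝓘(ℝ, B) M)) x₀) :
    ContDiffAt ℝ ∞ (vecRep X x₀) (extChartAt 𝓘(ℝ, B) x₀ x₀) := by
  have hIM : IsManifold 𝓘(ℝ, B) 1 M := IsManifold.of_le (n := ∞) (by simp)
  have h1 := ((trivializationAt B (TangentSpace 𝓘(ℝ, B)) x₀).contMDiffAt_section_iff
    (FiberBundle.mem_baseSet_trivializationAt' x₀)).1 hX
  have h2 : ContMDiffAt 𝓘(ℝ, B) 𝓘(ℝ, B) ∞ (extChartAt 𝓘(ℝ, B) x₀).symm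
      (extChartAt 𝓘(ℝ, B) x₀ x₀) :=
    (contMDiffOn_extChartAt_symm (I := 𝓘(ℝ, B)) (n := ∞) x₀).contMDiffAt
      ((isOpen_extChartAt_target x₀).mem_nhds (mem_extChartAt_target x₀))
  rw [← extChartAt_to_inv (I := 𝓘(ℝ, B)) x₀] at h1
  have h3 := (h1.comp _ h2).contDiffAt
  simp only [extChartAt_to_inv] at h3
  refine h3.congr_of_eventuallyEq ?_
  filter_upwards [(isOpen_extChartAt_target (I := 𝓘(ℝ, B)) x₀).mem_nhds (mem_extChartAt_target x₀)]
    with y hy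
  have hs := (extChartAt 𝓘(ℝ, B) x₀).map_target hy
  rw [extChartAt_source] at hs
  have h4 := DFunLike.congr_fun
    (TangentBundle.continuousLinearMapAt_trivializationAt (I := 𝓘(ℝ, B)) hs)
    (X ((extChartAt 𝓘(ℝ, B) x₀).symm y))
  refine h4.symm.trans ?_
  have h5 := Trivialization.linearMapAt_apply (R := ℝ)
    (trivializationAt B (TangentSpace 𝓘(ℝ, B)) x₀) (X ((extChartAt 𝓘(ℝ, B) x₀).symm y))
  rw [if_pos (by simpa using hs)] at h5
  exact h5

theorem chartRep_contract (X : ∀ x : M, TangentSpace 𝓘(ℝ, B) x) (w : ∀ x : M, Alt B (k + 1) x)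
    {x₀ : M} {y : B} (hy : y ∈ (extChartAt 𝓘(ℝ, B) x₀).target) :
    chartRep (fun x => contract (X x) (w x)) x₀ y
      = (chartRep w x₀ y).curryLeft (vecRep X x₀ y) := by
  ext u
  let w' : M → B [⋀^Fin (k + 1)]→L[ℝ] ℝ := w
  let D : B →L[ℝ] B := mfderiv 𝓘(ℝ, B) 𝓘(ℝ, B) (extChartAt 𝓘(ℝ, B) x₀).symm y
  have hD : D (vecRep X x₀ y) = X ((extChartAt 𝓘(ℝ, B) x₀).symm y) :=
    mfderiv_extChartAt_comp_symm hy _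
  change w' ((extChartAt 𝓘(ℝ, B) x₀).symm y)
      (Matrix.vecCons (X ((extChartAt 𝓘(ℝ, B) x₀).symm y)) (fun i => D (u i)))
    = w' ((extChartAt 𝓘(ℝ, B) x₀).symm y) (fun i => D (Matrix.vecCons (vecRep X x₀ y) u i))
  congr 1
  funext i
  refine Fin.cases ?_ (fun j => ?_) i
  · exact hD.symm
  · rfl

theorem SmoothFormAt.contract {X : ∀ x : M, TangentSpace 𝓘(ℝ, B) x} {x₀ : M}
    (hX : ContMDiffAt 𝓘(ℝ, B) (𝓘(ℝ, B).prod 𝓘(ℝ, B)) ∞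
      (fun x => (⟨x, X x⟩ : TangentBundle 𝓘(ℝ, B) M)) x₀)
    {w : ∀ x : M, Alt B (k + 1) x} (hw : SmoothFormAt w x₀) :
    SmoothFormAt (fun x => contract (X x) (w x)) x₀ := by
  have h1 : ContDiffAt ℝ ∞ (fun y => (chartRep w x₀ y).curryLeft (vecRep X x₀ y))
      (extChartAt 𝓘(ℝ, B) x₀ x₀) :=
    have h3 := contDiff_curryLeft (B := B) (k := k) (n := ∞)
    have h2 : ContDiffAt ℝ ∞ (fun y => (chartRep w x₀ y).curryLeft)
        (extChartAt 𝓘(ℝ, B) x₀ x₀) := h3.contDiffAt.comp _ hw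
    h2.clm_apply (contDiffAt_vecRep hX)
  refine ContDiffAt.congr_of_eventuallyEq h1 ?_
  filter_upwards [(isOpen_extChartAt_target (I := 𝓘(ℝ, B)) x₀).mem_nhds (mem_extChartAt_target x₀)]
    with y hy using chartRep_contract X w hy

end Contract

end Forms

/-! ### Cutting off local sections, and local sections of submersions -/

section Cutoff

variable {B : Type*} [NormedAddCommGroup B] [NormedSpace ℝ B] [FiniteDimensional ℝ B]
  {M : Type*} [TopologicalSpace M] [T2Space M] [ChartedSpace B M] [IsManifold 𝓘(ℝ, B) ∞ M]
  {F : Type*} [NormedAddCommGroup F] [NormedSpace ℝ F]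
  {E : M → Type*} [TopologicalSpace (TotalSpace F E)] [∀ x, AddCommGroup (E x)]
  [∀ x, Module ℝ (E x)] [∀ x, TopologicalSpace (E x)] [FiberBundle F E] [VectorBundle ℝ F E]

theorem exists_smooth_cutoff {x₀ : M} {u : Set M} (hu : u ∈ 𝓝 x₀) :
    ∃ φ : C^∞⟮𝓘(ℝ, B), M; ℝ⟯, (∀ᶠ x in 𝓝 x₀, φ x = 1) ∧ tsupport φ ⊆ u := by
  obtain ⟨f, -, hf⟩ := (SmoothBumpFunction.nhds_basis_tsupport (I := 𝓘(ℝ, B)) x₀).mem_iff.1 hu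
  exact ⟨⟨f, f.contMDiff⟩, f.eventuallyEq_one, hf⟩

/-- The clause `φ x ≠ 0 → P x` allows identities to be checked on all of `M`: either the cutoff
kills both sides or `P` is available. -/
theorem exists_sec_eq_smul {x₀ : M} {P : M → Prop} (hP : ∀ᶠ x in 𝓝 x₀, P x) {σ : ∀ x, E x}
    (hσ : ∀ x, P x → ContMDiffAt 𝓘(ℝ, B) (𝓘(ℝ, B).prod 𝓘(ℝ, F)) ∞
      (fun z => (⟨z, σ z⟩ : TotalSpace F E)) x) :
    ∃ (φ : C^∞⟮𝓘(ℝ, B), M; ℝ⟯) (s : Sec B F E), (∀ᶠ x in 𝓝 x₀, φ x = 1) ∧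
      (∀ x, φ x ≠ 0 → P x) ∧ ∀ x, s x = φ x • σ x := by
  obtain ⟨φ, h1, h2⟩ := exists_smooth_cutoff (B := B) (interior_mem_nhds.2 hP)
  have hs := ContMDiffOn.smul_section_of_tsupport (V := E) (s := σ) (ψ := φ)
    (φ.contMDiff.contMDiffOn) isOpen_interior h2
    (fun x hx => (hσ x (interior_subset hx)).contMDiffWithinAt)
  refine ⟨φ, ⟨fun x => φ x • σ x, hs⟩, h1, fun x hx => ?_, fun x => rfl⟩
  exact interior_subset (s := {x | P x}) (h2 (subset_tsupport _ hx))

theorem exists_sec_eventuallyEq {x₀ : M} {u : Set M} (hu : u ∈ 𝓝 x₀) {σ : ∀ x, E x}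
    (hσ : ContMDiffOn 𝓘(ℝ, B) (𝓘(ℝ, B).prod 𝓘(ℝ, F)) ∞
      (fun z => (⟨z, σ z⟩ : TotalSpace F E)) u) :
    ∃ s : Sec B F E, ∀ᶠ x in 𝓝 x₀, s x = σ x := by
  obtain ⟨φ, s, h1, -, h3⟩ := exists_sec_eq_smul (P := fun x => x ∈ interior u)
    (interior_mem_nhds.2 hu)
    (fun x hx => hσ.contMDiffAt (mem_interior_iff_mem_nhds.1 hx))
  exact ⟨s, h1.mono fun x hx => by rw [h3, hx, one_smul]⟩

variable [ContMDiffVectorBundle ∞ F E 𝓘(ℝ, B)]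

theorem exists_sec_eq (x₀ : M) (e : E x₀) : ∃ s : Sec B F E, s x₀ = e := by
  obtain ⟨u, hu, h⟩ := FiberBundle.exists_contMDiffOn_extend (k := ∞) 𝓘(ℝ, B) F e
  obtain ⟨s, hs⟩ := exists_sec_eventuallyEq hu h
  exact ⟨s, by simpa using hs.self_of_nhds⟩

theorem exists_sec_frame [FiniteDimensional ℝ F] (x₀ : M) :
    ∃ t : Fin (Module.finrank ℝ F) → Sec B F E, ∀ᶠ x in 𝓝 x₀,
      LinearIndependent ℝ (fun i => t i x) ∧ Submodule.span ℝ (Set.range fun i => t i x) = ⊤ := by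
  let e := trivializationAt F E x₀
  let b := Module.finBasis ℝ F
  have he := FiberBundle.mem_baseSet_trivializationAt' (F := F) (E := E) x₀
  have hb := e.open_baseSet.mem_nhds he
  choose t ht using fun i => exists_sec_eventuallyEq hb
    (e.contMDiffOn_localFrame_baseSet (I := 𝓘(ℝ, B)) ∞ b i)
  refine ⟨t, ?_⟩
  filter_upwards [Filter.eventually_all.2 ht, hb] with x hx hxb
  have hf := e.isLocalFrameOn_localFrame_baseSet 𝓘(ℝ, B) ∞ b
  simp only [hx]
  exact ⟨hf.linearIndependent hxb, top_le_iff.1 (hf.generating hxb)⟩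

end Cutoff

/-! ### Local sections of submersions. -/

section Submersion

variable {B : Type*} [NormedAddCommGroup B] [NormedSpace ℝ B]
  {M : Type*} [TopologicalSpace M] [ChartedSpace B M] [IsManifold 𝓘(ℝ, B) ∞ M]
  {B' : Type*} [NormedAddCommGroup B'] [NormedSpace ℝ B'] [FiniteDimensional ℝ B']
  {M' : Type*} [TopologicalSpace M'] [ChartedSpace B' M'] [IsManifold 𝓘(ℝ, B') ∞ M']

/-- A submersion has a smooth local section through every point. -/
theorem exists_local_section {f : M → M'} {x : M} (hf : ContMDiffAt 𝓘(ℝ, B) 𝓘(ℝ, B') ∞ f x)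
    (hs : Function.Surjective (mfderiv 𝓘(ℝ, B) 𝓘(ℝ, B') f x)) :
    ∃ σ : M' → M, σ (f x) = x ∧ ContMDiffAt 𝓘(ℝ, B') 𝓘(ℝ, B) ∞ σ (f x) ∧
      ∀ᶠ y in 𝓝 (f x), f (σ y) = y := by
  have : CompleteSpace B' := FiniteDimensional.complete ℝ B'
  let φ := extChartAt 𝓘(ℝ, B) x
  let ψ := extChartAt 𝓘(ℝ, B') (f x)
  have hg := contDiffAt_coordRep (mem_extChartAt_source x) (mem_extChartAt_source (f x)) hf
  have hgx : coordRep B B' f x (f x) (φ x) = ψ (f x) := by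
    simp only [coordRep, Function.comp_apply, φ, ψ, extChartAt_to_inv]
  have hD : fderiv ℝ (coordRep B B' f x (f x)) (φ x) = mfderiv 𝓘(ℝ, B) 𝓘(ℝ, B') f x := by
    refine Eq.trans ?_ (hf.mdifferentiableAt (by simp)).mfderiv.symm
    rw [modelWithCornersSelf_coe, Set.range_id, fderivWithin_univ]
    rfl
  obtain ⟨R, hR⟩ := SimpleQuotient.exists_rightInverse
    (fderiv ℝ (coordRep B B' f x (f x)) (φ x)) (by rw [hD]; exact hs)
  -- An affine slice through `φ x` transverse to the fiber. As `R` is a right inverse of the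
  -- derivative, the map restricted to the slice has derivative the identity at `0`, and the inverse
  -- function theorem applies.
  let a : B' → B := fun v => φ x + R v
  have ha : ContDiff ℝ ∞ a := contDiff_const.add R.contDiff
  have ha0 : a 0 = φ x := by simp [a]
  let h : B' → B' := coordRep B B' f x (f x) ∘ a
  have hh : ContDiffAt ℝ ∞ h 0 := by
    refine ContDiffAt.comp _ ?_ ha.contDiffAt
    rw [ha0]
    exact hg
  have hh' : HasFDerivAt h ((ContinuousLinearEquiv.refl ℝ B' : B' ≃L[ℝ] B') : B' →L[ℝ] B') 0 := by
    have h1 : HasFDerivAt (coordRep B B' f x (f x))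
        (fderiv ℝ (coordRep B B' f x (f x)) (φ x)) (a 0) := by
      rw [ha0]
      exact (hg.differentiableAt (by simp)).hasFDerivAt
    have h2 : HasFDerivAt a R 0 := R.hasFDerivAt.const_add _
    have h3 := h1.comp 0 h2
    convert h3 using 1
    ext v
    simp [hR]
  have hn : (∞ : ℕ∞ω) ≠ 0 := by simp
  let k := hh.localInverse hh' hn
  have h0 : h 0 = ψ (f x) := (congrArg (coordRep B B' f x (f x)) ha0).trans hgx
  have hk : ContDiffAt ℝ ∞ k (ψ (f x)) := h0 ▸ hh.to_localInverse hh' hn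
  have hk0 : k (ψ (f x)) = 0 := h0 ▸ hh.localInverse_apply_image hh' hn
  have hhk : ∀ᶠ z in 𝓝 (ψ (f x)), h (k z) = z :=
    h0 ▸ (hh.hasStrictFDerivAt' hh' hn).eventually_right_inverse
  have hψ : ContMDiffAt 𝓘(ℝ, B') 𝓘(ℝ, B') ∞ ψ (f x) := contMDiffAt_extChartAt
  have hak : ContMDiffAt 𝓘(ℝ, B') 𝓘(ℝ, B) ∞ (fun y => a (k (ψ y))) (f x) :=
    (ha.contDiffAt.comp _ hk).contMDiffAt.comp (f x) hψ
  have hak0 : a (k (ψ (f x))) = φ x := by rw [hk0, ha0]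
  have hφ : ContMDiffAt 𝓘(ℝ, B) 𝓘(ℝ, B) ∞ φ.symm (a (k (ψ (f x)))) := by
    rw [hak0]
    exact (contMDiffOn_extChartAt_symm (I := 𝓘(ℝ, B)) (n := ∞) x).contMDiffAt
      ((isOpen_extChartAt_target x).mem_nhds (mem_extChartAt_target x))
  have hσ : ContMDiffAt 𝓘(ℝ, B') 𝓘(ℝ, B) ∞ (fun y => φ.symm (a (k (ψ y)))) (f x) :=
    hφ.comp (f x) hak
  have hσ0 : φ.symm (a (k (ψ (f x)))) = x := by
    rw [hak0]
    exact extChartAt_to_inv x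
  refine ⟨_, hσ0, hσ, ?_⟩
  have hfσ : ContinuousAt (fun y => f (φ.symm (a (k (ψ y))))) (f x) := by
    refine ContinuousAt.comp (g := f) ?_ hσ.continuousAt
    rw [hσ0]
    exact hf.continuousAt
  have hfσ0 : f (φ.symm (a (k (ψ (f x))))) = f x := by rw [hσ0]
  have hsrc : ∀ᶠ y in 𝓝 (f x), f (φ.symm (a (k (ψ y)))) ∈ ψ.source :=
    hfσ ((isOpen_extChartAt_source (f x)).mem_nhds
      (by simp only [hfσ0]; exact mem_extChartAt_source (f x)))
  filter_upwards [hψ.continuousAt.eventually hhk, hsrc,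
    (isOpen_extChartAt_source (I := 𝓘(ℝ, B')) (f x)).mem_nhds (mem_extChartAt_source (f x))]
    with y h1 h2 h3
  exact ψ.injOn h2 h3 h1

end Submersion

/-! ### Lifting sections of the quotient bundle. -/

section Lift

variable {B : Type*} [NormedAddCommGroup B] [NormedSpace ℝ B] [FiniteDimensional ℝ B]
  {M : Type*} [TopologicalSpace M] [T2Space M] [ChartedSpace B M] [IsManifold 𝓘(ℝ, B) ∞ M]
  {F : Type*} [NormedAddCommGroup F] [NormedSpace ℝ F]
  {E : M → Type*} [TopologicalSpace (TotalSpace F E)] [∀ x, AddCommGroup (E x)]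
  [∀ x, Module ℝ (E x)] [∀ x, TopologicalSpace (E x)] [FiberBundle F E] [VectorBundle ℝ F E]
  [ContMDiffVectorBundle ∞ F E 𝓘(ℝ, B)]
  {B' : Type*} [NormedAddCommGroup B'] [NormedSpace ℝ B']
  {M' : Type*} [TopologicalSpace M'] [ChartedSpace B' M']
  {F' : Type*} [NormedAddCommGroup F'] [NormedSpace ℝ F'] [FiniteDimensional ℝ F']
  {E' : M' → Type*} [TopologicalSpace (TotalSpace F' E')] [∀ y, AddCommGroup (E' y)]
  [∀ y, Module ℝ (E' y)] [∀ y, TopologicalSpace (E' y)] [FiberBundle F' E']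
  [VectorBundle ℝ F' E'] [ContMDiffVectorBundle ∞ F' E' 𝓘(ℝ, B')]

/-- Every section of the quotient bundle is, near a given point and up to a cutoff function,
the image of a section. -/
theorem SimpleQuotient.exists_lift (q : SimpleQuotient B F E B' F' E') (s' : Sec B' F' E')
    (x₀ : M) : ∃ (φ : C^∞⟮𝓘(ℝ, B), M; ℝ⟯) (s : Sec B F E), (∀ᶠ x in 𝓝 x₀, φ x = 1) ∧
      ∀ x, q.map x (s x) = φ x • s' (q.base x) := by
  have : CompleteSpace F' := FiniteDimensional.complete ℝ F'
  let e := trivializationAt F' E' (q.base x₀)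
  have he : q.base x₀ ∈ e.baseSet := FiberBundle.mem_baseSet_trivializationAt' (q.base x₀)
  let b := Module.finBasis ℝ F'
  have hex : ∀ i, ∃ t : Sec B F E, q.map x₀ (t x₀) = (e.linearEquivAt ℝ _ he).symm (b i) := by
    intro i
    obtain ⟨v, hv⟩ := q.map_surjective x₀ ((e.linearEquivAt ℝ _ he).symm (b i))
    obtain ⟨t, ht⟩ := exists_sec_eq (B := B) (F := F) x₀ v
    exact ⟨t, by rw [ht, hv]⟩
  choose t ht using hex
  let τ : Fin (Module.finrank ℝ F') → M → F' := fun i x => (e ⟨q.base x, q.map x (t i x)⟩).2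
  let τ' : M → F' := fun x => (e ⟨q.base x, s' (q.base x)⟩).2
  have hτ : ∀ i x, q.base x ∈ e.baseSet → ContMDiffAt 𝓘(ℝ, B) 𝓘(ℝ, F') ∞ (τ i) x := by
    intro i x hx
    have h1 : ContMDiff 𝓘(ℝ, B) (𝓘(ℝ, B').prod 𝓘(ℝ, F')) ∞
        (fun x => (⟨q.base x, q.map x (t i x)⟩ : TotalSpace F' E')) :=
      q.map_smooth.comp (t i).contMDiff
    exact ((e.contMDiffAt_iff (f := fun x => (⟨q.base x, q.map x (t i x)⟩ : TotalSpace F' E'))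
      (e.mem_source.2 hx)).1 (h1 x)).2
  have hτ' : ∀ x, q.base x ∈ e.baseSet → ContMDiffAt 𝓘(ℝ, B) 𝓘(ℝ, F') ∞ τ' x := by
    intro x hx
    have h1 : ContMDiff 𝓘(ℝ, B) (𝓘(ℝ, B').prod 𝓘(ℝ, F')) ∞
        (fun x => (⟨q.base x, s' (q.base x)⟩ : TotalSpace F' E')) :=
      s'.contMDiff.comp q.base_smooth
    exact ((e.contMDiffAt_iff (f := fun x => (⟨q.base x, s' (q.base x)⟩ : TotalSpace F' E'))
      (e.mem_source.2 hx)).1 (h1 x)).2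
  let co : Fin (Module.finrank ℝ F') → F' →L[ℝ] ℝ := fun i => (b.coord i).toContinuousLinearMap
  -- `Q x` sends the basis vector `b i` to the trivialized `q (t i x)`. It is the identity at `x₀`,
  -- hence invertible nearby, and `c` below solves `Q x (c x) = τ' x` for the coefficients of the
  -- lift.
  let Q : M → F' →L[ℝ] F' := fun x => ∑ i, (co i).smulRight (τ i x)
  have hQ : ∀ x, q.base x ∈ e.baseSet → ContMDiffAt 𝓘(ℝ, B) 𝓘(ℝ, F' →L[ℝ] F') ∞ Q x := by
    intro x hx
    refine ContMDiffAt.sum fun i _ => ?_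
    exact ((ContinuousLinearMap.smulRightL ℝ F' F' (co i)).contDiff.contMDiff.contMDiffAt).comp x
      (hτ i x hx)
  have hQ0 : Q x₀ = 1 := by
    refine ContinuousLinearMap.ext fun v => ?_
    have h1 : ∀ i, τ i x₀ = b i := by
      intro i
      have h2 : (e.linearEquivAt ℝ _ he) (q.map x₀ (t i x₀)) = b i := by
        rw [ht, LinearEquiv.apply_symm_apply]
      exact h2
    simp only [Q, co, h1, sum_apply, ContinuousLinearMap.smulRight_apply]
    exact b.sum_repr v
  let P : M → Prop := fun x => q.base x ∈ e.baseSet ∧ IsUnit (Q x)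
  have hP : ∀ᶠ x in 𝓝 x₀, P x := by
    refine Filter.Eventually.and
      (q.base_smooth.continuous.continuousAt (e.open_baseSet.mem_nhds he)) ?_
    exact (hQ x₀ he).continuousAt (Units.isOpen.mem_nhds (by rw [hQ0]; exact isUnit_one))
  let c : M → F' := fun x => Ring.inverse (Q x) (τ' x)
  have hc : ∀ x, P x → ContMDiffAt 𝓘(ℝ, B) 𝓘(ℝ, F') ∞ c x := by
    rintro x ⟨hx, U, hU⟩
    have h1 : ContDiffAt ℝ ∞ Ring.inverse (Q x) := hU ▸ contDiffAt_ringInverse ℝ U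
    exact (h1.contMDiffAt.comp x (hQ x hx)).clm_apply (hτ' x hx)
  obtain ⟨φ, s, h1, h2, h3⟩ := exists_sec_eq_smul (B := B) (F := F) hP
    (σ := fun x => ∑ i, co i (c x) • t i x) (fun x hx => by
      refine ContMDiffAt.sum_section fun i _ => ?_
      refine ContMDiffAt.smul_section (f := fun x => co i (c x)) ?_ (t i).contMDiff.contMDiffAt
      exact (co i).contDiff.contMDiff.contMDiffAt.comp x (hc x hx))
  refine ⟨φ, s, h1, fun x => ?_⟩
  rw [h3, map_smul]
  by_cases hx : φ x = 0
  · rw [hx, zero_smul, zero_smul]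
  obtain ⟨hx1, hx2⟩ := h2 x hx
  congr 1
  apply (e.linearEquivAt ℝ _ hx1).injective
  have h4 : (e.linearEquivAt ℝ _ hx1) (q.map x (∑ i, co i (c x) • t i x)) = Q x (c x) := by
    simp only [map_sum, map_smul, Q, sum_apply,
      ContinuousLinearMap.smulRight_apply]
    rfl
  rw [h4]
  have h5 : Q x * Ring.inverse (Q x) = 1 := Ring.mul_inverse_cancel _ hx2
  exact congrArg (fun L : F' →L[ℝ] F' => L (τ' x)) h5

end Lift

/-! ### Vector fields as derivations, and the anchor as a morphism of brackets -/

section VectorFields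

variable {B : Type*} [NormedAddCommGroup B] [NormedSpace ℝ B]
  {M : Type*} [TopologicalSpace M] [ChartedSpace B M] [IsManifold 𝓘(ℝ, B) ∞ M]

/-- Pulling a field back along the inverse chart gives `vecRep` on the chart target, and the outer
derivative in the definition of `mlieBracket` is the identity at the centre of the chart. -/
theorem mlieBracket_eq_lieBracket_vecRep (X Y : ∀ x : M, TangentSpace 𝓘(ℝ, B) x) (x : M) :
    VectorField.mlieBracket 𝓘(ℝ, B) X Y x
      = VectorField.lieBracket ℝ (vecRep X x) (vecRep Y x) (extChartAt 𝓘(ℝ, B) x x) := by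
  have hIM : IsManifold 𝓘(ℝ, B) 1 M := IsManifold.of_le (n := ∞) (by simp)
  have hrep : ∀ Z : ∀ x : M, TangentSpace 𝓘(ℝ, B) x,
      (VectorField.mpullbackWithin 𝓘(ℝ, B) 𝓘(ℝ, B) (extChartAt 𝓘(ℝ, B) x).symm Z
        (Set.range 𝓘(ℝ, B)) : B → B) =ᶠ[𝓝 (extChartAt 𝓘(ℝ, B) x x)] vecRep Z x := by
    intro Z
    filter_upwards [(isOpen_extChartAt_target (I := 𝓘(ℝ, B)) x).mem_nhds
      (mem_extChartAt_target x)] with y hy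
    have h1 := mfderiv_extChartAt_comp_mfderivWithin_extChartAt_symm (I := 𝓘(ℝ, B)) hy
    have h2 := mfderivWithin_extChartAt_symm_comp_mfderiv_extChartAt (I := 𝓘(ℝ, B)) hy
    have h3 := ContinuousLinearMap.inverse_eq h2 h1
    exact DFunLike.congr_fun h3 (Z ((extChartAt 𝓘(ℝ, B) x).symm y))
  have h0 := VectorField.mlieBracketWithin_apply (I := 𝓘(ℝ, B)) (s := Set.univ) (x₀ := x)
    (V := X) (W := Y)
  rw [mfderiv_extChartAt_self] at h0
  have hid : (ContinuousLinearMap.id ℝ B).inverse = ContinuousLinearMap.id ℝ B :=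
    ContinuousLinearMap.inverse_id
  have hfin : ∀ V W : B → B,
      VectorField.lieBracketWithin ℝ V W ((extChartAt 𝓘(ℝ, B) x).symm ⁻¹' Set.univ ∩
        Set.range 𝓘(ℝ, B)) (extChartAt 𝓘(ℝ, B) x x)
        = VectorField.lieBracket ℝ V W (extChartAt 𝓘(ℝ, B) x x) := by
    intro V W
    rw [Set.preimage_univ, Set.univ_inter, modelWithCornersSelf_coe, Set.range_id,
      VectorField.lieBracketWithin_univ]
  let V : B → B := VectorField.mpullbackWithin 𝓘(ℝ, B) 𝓘(ℝ, B) (extChartAt 𝓘(ℝ, B) x).symm X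
    (Set.range 𝓘(ℝ, B))
  let W : B → B := VectorField.mpullbackWithin 𝓘(ℝ, B) 𝓘(ℝ, B) (extChartAt 𝓘(ℝ, B) x).symm Y
    (Set.range 𝓘(ℝ, B))
  have h1 : VectorField.lieBracket ℝ V W (extChartAt 𝓘(ℝ, B) x x) = _ :=
    (hrep X).lieBracket_vectorField_eq (𝕜 := ℝ) (hrep Y)
  exact (h0.trans (DFunLike.congr_fun hid _)).trans ((hfin V W).trans h1)

theorem dirDeriv_eq_fderiv {f : M → ℝ} {x₀ x : M} (hx : x ∈ (extChartAt 𝓘(ℝ, B) x₀).source)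
    (hf : MDifferentiableAt 𝓘(ℝ, B) 𝓘(ℝ, ℝ) f x) (v : TangentSpace 𝓘(ℝ, B) x) :
    dirDeriv v f = fderiv ℝ (f ∘ (extChartAt 𝓘(ℝ, B) x₀).symm) (extChartAt 𝓘(ℝ, B) x₀ x)
      ((mfderiv 𝓘(ℝ, B) 𝓘(ℝ, B) (extChartAt 𝓘(ℝ, B) x₀) x : B →L[ℝ] B) v) := by
  have hIM : IsManifold 𝓘(ℝ, B) 1 M := IsManifold.of_le (n := ∞) (by simp)
  let φ := extChartAt 𝓘(ℝ, B) x₀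
  have hφ : MDifferentiableAt 𝓘(ℝ, B) 𝓘(ℝ, B) φ x :=
    mdifferentiableAt_extChartAt (by rwa [extChartAt_source] at hx)
  have hxy : φ.symm (φ x) = x := φ.left_inv hx
  have h1 : MDifferentiableAt 𝓘(ℝ, B) 𝓘(ℝ, ℝ) (f ∘ φ.symm) (φ x) := by
    refine MDifferentiableAt.comp (φ x) ?_ (mdifferentiableAt_extChartAt_symm (φ.map_source hx))
    rwa [hxy]
  have h2 : mfderiv 𝓘(ℝ, B) 𝓘(ℝ, ℝ) ((f ∘ φ.symm) ∘ φ) x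
      = (mfderiv 𝓘(ℝ, B) 𝓘(ℝ, ℝ) (f ∘ φ.symm) (φ x)).comp (mfderiv 𝓘(ℝ, B) 𝓘(ℝ, B) φ x) :=
    mfderiv_comp x h1 hφ
  have h3 : ((f ∘ φ.symm) ∘ φ) =ᶠ[𝓝 x] f := by
    filter_upwards [(isOpen_extChartAt_source (I := 𝓘(ℝ, B)) x₀).mem_nhds hx] with z hz
    exact congrArg f (φ.left_inv hz)
  rw [mfderiv_eq_fderiv] at h2
  have h4 := h3.mfderiv_eq (I := 𝓘(ℝ, B)) (I' := 𝓘(ℝ, ℝ))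
  have h5 := DFunLike.congr_fun h2 v
  have h6 : (mfderiv 𝓘(ℝ, B) 𝓘(ℝ, ℝ) ((f ∘ φ.symm) ∘ φ) x : B →L[ℝ] ℝ) v
      = (mfderiv 𝓘(ℝ, B) 𝓘(ℝ, ℝ) f x : B →L[ℝ] ℝ) v :=
    congrArg (fun L : B →L[ℝ] ℝ => L v) h4
  exact h6.symm.trans h5

theorem vecRep_self (X : ∀ x : M, TangentSpace 𝓘(ℝ, B) x) (x : M) :
    vecRep X x (extChartAt 𝓘(ℝ, B) x x) = X x := by
  have hIM : IsManifold 𝓘(ℝ, B) 1 M := IsManifold.of_le (n := ∞) (by simp)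
  unfold vecRep
  rw [extChartAt_to_inv, mfderiv_extChartAt_self]
  rfl

theorem dirDeriv_eq_fderiv_vecRep {f : M → ℝ} (hf : ContMDiff 𝓘(ℝ, B) 𝓘(ℝ, ℝ) ∞ f)
    (X : ∀ x : M, TangentSpace 𝓘(ℝ, B) x) {x₀ : M} {y : B}
    (hy : y ∈ (extChartAt 𝓘(ℝ, B) x₀).target) :
    dirDeriv (X ((extChartAt 𝓘(ℝ, B) x₀).symm y)) f
      = fderiv ℝ (f ∘ (extChartAt 𝓘(ℝ, B) x₀).symm) y (vecRep X x₀ y) := by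
  rw [dirDeriv_eq_fderiv ((extChartAt 𝓘(ℝ, B) x₀).map_target hy)
    ((hf _).mdifferentiableAt (by simp)), (extChartAt 𝓘(ℝ, B) x₀).right_inv hy]
  rfl

theorem contMDiff_dirDeriv {f : M → ℝ} (hf : ContMDiff 𝓘(ℝ, B) 𝓘(ℝ, ℝ) ∞ f)
    {X : ∀ x : M, TangentSpace 𝓘(ℝ, B) x}
    (hX : ContMDiff 𝓘(ℝ, B) (𝓘(ℝ, B).prod 𝓘(ℝ, B)) ∞
      (fun x => (⟨x, X x⟩ : TangentBundle 𝓘(ℝ, B) M))) :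
    ContMDiff 𝓘(ℝ, B) 𝓘(ℝ, ℝ) ∞ (fun x => dirDeriv (X x) f) := by
  have hIM : IsManifold 𝓘(ℝ, B) 1 M := IsManifold.of_le (n := ∞) (by simp)
  have h1 := hf.contMDiff_tangentMap (m := ∞) (by simp)
  have h2 := contMDiff_snd_tangentBundle_modelSpace (n := ∞) ℝ 𝓘(ℝ, ℝ)
  exact h2.comp (h1.comp hX)

theorem contDiffAt_comp_extChartAt_symm {f : M → ℝ} (hf : ContMDiff 𝓘(ℝ, B) 𝓘(ℝ, ℝ) ∞ f) (x : M) :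
    ContDiffAt ℝ ∞ (f ∘ (extChartAt 𝓘(ℝ, B) x).symm) (extChartAt 𝓘(ℝ, B) x x) :=
  (hf.contMDiffAt.comp _ ((contMDiffOn_extChartAt_symm (I := 𝓘(ℝ, B)) (n := ∞) x).contMDiffAt
    ((isOpen_extChartAt_target x).mem_nhds (mem_extChartAt_target x)))).contDiffAt

/-- Each iterated derivative is a second-derivative term of `g` plus a derivative of the field
(`key`). The second-derivative terms cancel by symmetry and the rest is the bracket in the chart. -/
theorem dirDeriv_mlieBracket {f : M → ℝ} (hf : ContMDiff 𝓘(ℝ, B) 𝓘(ℝ, ℝ) ∞ f)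
    {X Y : ∀ x : M, TangentSpace 𝓘(ℝ, B) x}
    (hX : ContMDiff 𝓘(ℝ, B) (𝓘(ℝ, B).prod 𝓘(ℝ, B)) ∞
      (fun x => (⟨x, X x⟩ : TangentBundle 𝓘(ℝ, B) M)))
    (hY : ContMDiff 𝓘(ℝ, B) (𝓘(ℝ, B).prod 𝓘(ℝ, B)) ∞
      (fun x => (⟨x, Y x⟩ : TangentBundle 𝓘(ℝ, B) M))) (x : M) :
    dirDeriv (VectorField.mlieBracket 𝓘(ℝ, B) X Y x) f
      = dirDeriv (X x) (fun z => dirDeriv (Y z) f)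
        - dirDeriv (Y x) (fun z => dirDeriv (X z) f) := by
  let φ := extChartAt 𝓘(ℝ, B) x
  let g : B → ℝ := f ∘ φ.symm
  have hIM : IsManifold 𝓘(ℝ, B) 1 M := IsManifold.of_le (n := ∞) (by simp)
  have hg : ContDiffAt ℝ ∞ g (φ x) := contDiffAt_comp_extChartAt_symm hf x
  have hself : ∀ (v : TangentSpace 𝓘(ℝ, B) x) {f : M → ℝ}
      (_ : ContMDiff 𝓘(ℝ, B) 𝓘(ℝ, ℝ) ∞ f),
      dirDeriv v f = fderiv ℝ (f ∘ φ.symm) (φ x) (v : B) := by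
    intro v f hf
    rw [dirDeriv_eq_fderiv (mem_extChartAt_source x) ((hf x).mdifferentiableAt (by simp)),
      mfderiv_extChartAt_self]
    rfl
  have key : ∀ {X Y : ∀ x : M, TangentSpace 𝓘(ℝ, B) x}
      (_ : ContMDiff 𝓘(ℝ, B) (𝓘(ℝ, B).prod 𝓘(ℝ, B)) ∞
        (fun x => (⟨x, Y x⟩ : TangentBundle 𝓘(ℝ, B) M))),
      dirDeriv (X x) (fun z => dirDeriv (Y z) f)
        = fderiv ℝ (fderiv ℝ g) (φ x) (vecRep X x (φ x)) (vecRep Y x (φ x))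
          + fderiv ℝ g (φ x) (fderiv ℝ (vecRep Y x) (φ x) (vecRep X x (φ x))) := by
    intro X Y hY
    rw [hself _ (contMDiff_dirDeriv hf hY)]
    have h1 : ((fun z => dirDeriv (Y z) f) ∘ φ.symm) =ᶠ[𝓝 (φ x)]
        fun y => fderiv ℝ g y (vecRep Y x y) := by
      filter_upwards [(isOpen_extChartAt_target (I := 𝓘(ℝ, B)) x).mem_nhds
        (mem_extChartAt_target x)] with y hy
      exact dirDeriv_eq_fderiv_vecRep hf Y hy
    have h2 : DifferentiableAt ℝ (fderiv ℝ g) (φ x) :=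
      (hg.fderiv_right (m := 1) (WithTop.coe_le_coe.2 le_top)).differentiableAt (by simp)
    have h3 : DifferentiableAt ℝ (vecRep Y x) (φ x) :=
      (contDiffAt_vecRep (hY x)).differentiableAt (by simp)
    rw [h1.fderiv_eq, fderiv_clm_apply h2 h3, ← vecRep_self X x]
    simp only [_root_.add_apply, ContinuousLinearMap.comp_apply,
      ContinuousLinearMap.flip_apply]
    exact add_comm _ _
  have hsymm : IsSymmSndFDerivAt ℝ g (φ x) := hg.isSymmSndFDerivAt
    (by rw [minSmoothness_of_isRCLikeNormedField]; exact WithTop.coe_le_coe.2 le_top)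
  rw [key hY, key hX, hself _ hf, mlieBracket_eq_lieBracket_vecRep, VectorField.lieBracket_eq,
    hsymm (vecRep X x (φ x)) (vecRep Y x (φ x))]
  change fderiv ℝ g (φ x) (_ - _) = _
  rw [map_sub]
  simp only [φ]
  abel

/-- Smooth functions separate tangent vectors. -/
theorem eq_of_forall_dirDeriv_eq [FiniteDimensional ℝ B] [T2Space M] {x : M}
    {v w : TangentSpace 𝓘(ℝ, B) x} (h : ∀ f : C^∞⟮𝓘(ℝ, B), M; ℝ⟯, dirDeriv v f = dirDeriv w f) :
    v = w := by
  have hIM : IsManifold 𝓘(ℝ, B) 1 M := IsManifold.of_le (n := ∞) (by simp)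
  let φ := extChartAt 𝓘(ℝ, B) x
  have key : ∀ ℓ : B →L[ℝ] ℝ, ℓ (v : B) = ℓ (w : B) := by
    intro ℓ
    obtain ⟨χ, h1, h2⟩ := exists_smooth_cutoff (B := B) (extChartAt_source_mem_nhds (I := 𝓘(ℝ, B)) x)
    -- The test functions are linear functionals of the chart, cut off near `x`; their derivative at
    -- `x` is `ℓ` itself.
    have hs : ContMDiff 𝓘(ℝ, B) 𝓘(ℝ, ℝ) ∞ (fun z => χ z • ℓ (φ z)) := by
      refine contMDiff_of_tsupport fun z hz => ?_
      have hz' := h2 (tsupport_smul_subset_left _ _ hz)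
      rw [extChartAt_source] at hz'
      exact (χ.contMDiff z).smul (ℓ.contDiff.contMDiff.contMDiffAt.comp z
        (contMDiffAt_extChartAt' hz'))
    have hd : ∀ u : TangentSpace 𝓘(ℝ, B) x, dirDeriv u (fun z => χ z • ℓ (φ z)) = ℓ (u : B) := by
      intro u
      rw [dirDeriv_eq_fderiv (mem_extChartAt_source x) ((hs x).mdifferentiableAt (by simp)),
        mfderiv_extChartAt_self]
      have h3 : ((fun z => χ z • ℓ (φ z)) ∘ φ.symm) =ᶠ[𝓝 (φ x)] ℓ := by
        have hc : Filter.Tendsto φ.symm (𝓝 (φ x)) (𝓝 x) := by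
          have := continuousAt_extChartAt_symm (I := 𝓘(ℝ, B)) x
          rwa [ContinuousAt, extChartAt_to_inv] at this
        filter_upwards [hc.eventually h1, (isOpen_extChartAt_target (I := 𝓘(ℝ, B)) x).mem_nhds
          (mem_extChartAt_target x)] with y hy1 hy2
        simp only [Function.comp_apply, hy1, one_smul]
        exact congrArg ℓ (φ.right_inv hy2)
      rw [h3.fderiv_eq, ℓ.fderiv]
      rfl
    have h4 := h ⟨_, hs⟩
    exact (hd v).symm.trans (h4.trans (hd w))
  let v' : B := v
  let w' : B := w
  have h5 : v' - w' = 0 := SeparatingDual.eq_zero_of_forall_dual_eq_zero (R := ℝ) fun ℓ => by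
    rw [map_sub]
    exact sub_eq_zero.2 (key ℓ)
  exact sub_eq_zero.1 h5

end VectorFields

/-! ### The anchor preserves brackets. -/

section Anchor

variable {B : Type*} [NormedAddCommGroup B] [NormedSpace ℝ B] [FiniteDimensional ℝ B]
  {M : Type*} [TopologicalSpace M] [T2Space M] [ChartedSpace B M] [IsManifold 𝓘(ℝ, B) ∞ M]
  {F : Type*} [NormedAddCommGroup F] [NormedSpace ℝ F]
  {E : M → Type*} [TopologicalSpace (TotalSpace F E)] [∀ x, AddCommGroup (E x)]
  [∀ x, Module ℝ (E x)] [∀ x, TopologicalSpace (E x)] [FiberBundle F E] [VectorBundle ℝ F E]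
  (A : LieAlgebroid B F E)

omit [FiniteDimensional ℝ B] [T2Space M] in
theorem LieAlgebroid.contMDiff_anchorSec (s : Sec B F E) :
    ContMDiff 𝓘(ℝ, B) (𝓘(ℝ, B).prod 𝓘(ℝ, B)) ∞
      (fun x => (⟨x, A.anchorSec s x⟩ : TangentBundle 𝓘(ℝ, B) M)) :=
  A.anchor_smooth.comp s.contMDiff

-- Expand the Jacobi identity for `s`, `t`, `f u` by the Leibniz rule. The terms in `f` cancel by
-- Jacobi for `s`, `t`, `u`, the mixed terms cancel in pairs, and what remains is a multiple of `u`.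
omit [FiniteDimensional ℝ B] [T2Space M] in
theorem LieAlgebroid.dirDeriv_anchor_bracket_smul (s t u : Sec B F E)
    (f : C^∞⟮𝓘(ℝ, B), M; ℝ⟯) (x : M) :
    dirDeriv (A.anchor x (A.bracket s t x)) f • u x
      = (dirDeriv (A.anchor x (s x)) (fun z => dirDeriv (A.anchorSec t z) f)
        - dirDeriv (A.anchor x (t x)) (fun z => dirDeriv (A.anchorSec s z) f)) • u x := by
  have hsm : ∀ r : Sec B F E, ContMDiff 𝓘(ℝ, B) 𝓘(ℝ, ℝ) ∞ (fun z => dirDeriv (A.anchorSec r z) f) :=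
    fun r => contMDiff_dirDeriv f.contMDiff (A.contMDiff_anchorSec r)
  let g : Sec B F E → C^∞⟮𝓘(ℝ, B), M; ℝ⟯ := fun r => ⟨_, hsm r⟩
  have h1 : ∀ r : Sec B F E, A.bracket r (smulSec f u)
      = smulSec f (A.bracket r u) + smulSec (g r) u := by
    intro r
    ext z
    exact A.leibniz r u f z
  have h2 : ∀ r r' : Sec B F E, A.bracket r (A.bracket r' (smulSec f u)) x
      = f x • A.bracket r (A.bracket r' u) x + dirDeriv (A.anchor x (r x)) f • A.bracket r' u x
        + (dirDeriv (A.anchorSec r' x) f • A.bracket r u x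
          + dirDeriv (A.anchor x (r x)) (fun z => dirDeriv (A.anchorSec r' z) f) • u x) := by
    intro r r'
    rw [h1, map_add]
    exact congrArg₂ (· + ·) (A.leibniz r (A.bracket r' u) f x) (A.leibniz r u (g r') x)
  have h3 := DFunLike.congr_fun (A.jacobi s t (smulSec f u)) x
  have h4 := DFunLike.congr_fun (A.jacobi s t u) x
  rw [ContMDiffSection.coe_add, Pi.add_apply] at h3 h4
  rw [h2, h2, A.leibniz, h4] at h3
  simp only [LieAlgebroid.anchorSec] at h3 ⊢
  rw [sub_smul, eq_sub_iff_add_eq]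
  rw [smul_add] at h3
  have h5 := sub_eq_zero.2 h3
  rw [← sub_eq_zero, ← neg_eq_zero, ← h5]
  abel

/-- The anchor of a Lie algebroid takes the bracket to the Lie bracket of vector fields. -/
theorem LieAlgebroid.anchor_bracket [ContMDiffVectorBundle ∞ F E 𝓘(ℝ, B)] (s t : Sec B F E)
    (x : M) : A.anchor x (A.bracket s t x)
      = VectorField.mlieBracket 𝓘(ℝ, B) (A.anchorSec s) (A.anchorSec t) x := by
  -- The factor `u x` can be cancelled only if some section is nonzero at `x`.
  by_cases hE : ∃ e : E x, e ≠ 0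
  · obtain ⟨e, he⟩ := hE
    obtain ⟨u, hu⟩ := exists_sec_eq (B := B) (F := F) x e
    refine eq_of_forall_dirDeriv_eq fun f => ?_
    rw [dirDeriv_mlieBracket f.contMDiff (A.contMDiff_anchorSec s) (A.contMDiff_anchorSec t)]
    have h := A.dirDeriv_anchor_bracket_smul s t u f x
    rw [hu] at h
    exact smul_left_injective ℝ he h
  -- A zero fiber at `x` forces the model fiber, hence every fiber, to vanish, and both sides are
  -- zero.
  · push Not at hE
    have hz : ∀ (z : M) (e : E z), e = 0 := by
      intro z e
      let e₁ := trivializationAt F E x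
      let e₂ := trivializationAt F E z
      let l₁ := e₁.linearEquivAt ℝ x (FiberBundle.mem_baseSet_trivializationAt' x)
      let l₂ := e₂.linearEquivAt ℝ z (FiberBundle.mem_baseSet_trivializationAt' z)
      have h := hE (l₁.symm (l₂ e))
      simpa using h
    have hs : A.anchorSec s = 0 := by
      funext z
      simp only [LieAlgebroid.anchorSec, hz z (s z), map_zero]
      rfl
    rw [hs, VectorField.mlieBracket_zero_left, hz x (A.bracket s t x), map_zero]
    rfl

end Anchor

set_option linter.unusedSectionVars false

/-! ### Forms and Lie derivatives along submersions -/

section Submersion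

variable {B : Type*} [NormedAddCommGroup B] [NormedSpace ℝ B]
  {M : Type*} [TopologicalSpace M] [ChartedSpace B M] [IsManifold 𝓘(ℝ, B) ∞ M]
  {B' : Type*} [NormedAddCommGroup B'] [NormedSpace ℝ B']
  {M' : Type*} [TopologicalSpace M'] [ChartedSpace B' M'] [IsManifold 𝓘(ℝ, B') ∞ M']
  {k : ℕ}

/-- The Lie derivative is natural for related vector fields. -/
theorem lieDer_pullForm {f : M → M'} {x : M} (hf : ContMDiffAt 𝓘(ℝ, B) 𝓘(ℝ, B') ∞ f x)
    [FiniteDimensional ℝ B'] {X : ∀ x : M, TangentSpace 𝓘(ℝ, B) x}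
    {X' : ∀ y : M', TangentSpace 𝓘(ℝ, B') y}
    (hX : ∀ᶠ z in 𝓝 x, mfderiv 𝓘(ℝ, B) 𝓘(ℝ, B') f z (X z) = X' (f z))
    (hX' : ContMDiffAt 𝓘(ℝ, B') (𝓘(ℝ, B').prod 𝓘(ℝ, B')) ∞
      (fun y => (⟨y, X' y⟩ : TangentBundle 𝓘(ℝ, B') M')) (f x))
    {w : ∀ x : M, Alt B (k + 1) x} {w' : ∀ y : M', Alt B' (k + 1) y}
    (hw : ∀ᶠ z in 𝓝 x, w z = pullForm f w' z) (hw' : SmoothFormAt w' (f x)) :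
    lieDer X w x = pullAt f (k + 1) x (lieDer X' w' (f x)) := by
  have h1 : extD w x = pullAt f (k + 2) x (extD w' (f x)) :=
    (extD_congr hw).trans (extD_pullForm hf hw')
  have h2 : extD (fun z => contract (X z) (w z)) x
      = pullAt f (k + 1) x (extD (fun y => contract (X' y) (w' y)) (f x)) := by
    refine (extD_congr ?_).trans (extD_pullForm hf (hw'.contract hX'))
    filter_upwards [hX, hw] with z hz1 hz2
    rw [hz2, pullForm, contract_pullAt, hz1]
    rfl
  unfold lieDer
  rw [h1, h2, contract_pullAt, hX.self_of_nhds, map_add]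

omit [IsManifold 𝓘(ℝ, B) ∞ M] [IsManifold 𝓘(ℝ, B') ∞ M'] in
theorem pullForm_congr {f g : M → M'} {x : M} (h : ∀ᶠ z in 𝓝 x, f z = g z)
    {w : ∀ y : M', Alt B' k y} : pullForm (B := B) f w x = pullForm g w x := by
  have h1 : f =ᶠ[𝓝 x] g := h
  have h2 : (mfderiv 𝓘(ℝ, B) 𝓘(ℝ, B') f x : B →L[ℝ] B')
    = (mfderiv 𝓘(ℝ, B) 𝓘(ℝ, B') g x : B →L[ℝ] B') := h1.mfderiv_eq
  let w₀ : M' → B' [⋀^Fin k]→L[ℝ] ℝ := w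
  exact congrArg₂ (fun y (L : B →L[ℝ] B') => (w₀ y).compContinuousLinearMap L)
    h1.self_of_nhds h2

/-- A form is smooth if its pullback along a submersion is. -/
theorem smoothFormAt_of_pullForm [FiniteDimensional ℝ B] [FiniteDimensional ℝ B'] {f : M → M'}
    (hf : ContMDiff 𝓘(ℝ, B) 𝓘(ℝ, B') ∞ f) {x : M}
    (hs : Function.Surjective (mfderiv 𝓘(ℝ, B) 𝓘(ℝ, B') f x))
    {w : ∀ x : M, Alt B k x} {w' : ∀ y : M', Alt B' k y}
    (hw : SmoothFormAt w x) (h : ∀ᶠ z in 𝓝 x, w z = pullForm f w' z) :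
    SmoothFormAt w' (f x) := by
  -- Near `f x`, `w' = σ^* (f^* w') = σ^* w` for a local section `σ` through `x`, and the last form
  -- is smooth.
  obtain ⟨σ, h1, h2, h3⟩ := exists_local_section hf.contMDiffAt hs
  have h4 : SmoothFormAt (pullForm (B := B') σ w) (f x) := SmoothFormAt.pullForm h2 (by rwa [h1])
  refine h4.congr ?_
  have h5 : ∀ᶠ y in 𝓝 (f x), w (σ y) = pullForm f w' (σ y) := by
    have := h2.continuousAt
    rw [ContinuousAt, h1] at this
    exact this.eventually h
  have h6 : ∀ᶠ y in 𝓝 (f x), ContMDiffAt 𝓘(ℝ, B') 𝓘(ℝ, B) 1 σ y :=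
    (contMDiffAt_iff_contMDiffAt_nhds (by simp)).1 (h2.of_le (by simp))
  filter_upwards [h5, h6, h3.eventually_nhds] with y hy5 hy6 hy3
  have h7 : pullForm σ (pullForm (B := B) f w') y = pullForm (B := B') (f ∘ σ) w' y := by
    have hc : mfderiv 𝓘(ℝ, B') 𝓘(ℝ, B') (f ∘ σ) y = (mfderiv 𝓘(ℝ, B) 𝓘(ℝ, B') f (σ y)).comp
        (mfderiv 𝓘(ℝ, B') 𝓘(ℝ, B) σ y) :=
      mfderiv_comp y ((hf _).mdifferentiableAt (by simp)) (hy6.mdifferentiableAt (by simp))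
    ext v
    change _ = w' (f (σ y)) (fun i => mfderiv 𝓘(ℝ, B') 𝓘(ℝ, B') (f ∘ σ) y (v i))
    rw [hc]
    rfl
  refine Eq.trans (congrArg (pullAt σ k y) hy5) (h7.trans ((pullForm_congr hy3).trans ?_))
  exact congrFun (pullForm_id w') y

end Submersion

/-! ### Quotients of IM 2-forms -/

section Quotient

variable {B : Type*} [NormedAddCommGroup B] [NormedSpace ℝ B] [FiniteDimensional ℝ B]
  {M : Type*} [TopologicalSpace M] [T2Space M] [ChartedSpace B M] [IsManifold 𝓘(ℝ, B) ∞ M]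
  {F : Type*} [NormedAddCommGroup F] [NormedSpace ℝ F] [FiniteDimensional ℝ F]
  {E : M → Type*} [TopologicalSpace (TotalSpace F E)] [∀ x, AddCommGroup (E x)]
  [∀ x, Module ℝ (E x)] [∀ x, TopologicalSpace (E x)] [FiberBundle F E] [VectorBundle ℝ F E]
  [ContMDiffVectorBundle ∞ F E 𝓘(ℝ, B)]
  {B' : Type*} [NormedAddCommGroup B'] [NormedSpace ℝ B'] [FiniteDimensional ℝ B']
  {M' : Type*} [TopologicalSpace M'] [T2Space M'] [ChartedSpace B' M'] [IsManifold 𝓘(ℝ, B') ∞ M']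
  {F' : Type*} [NormedAddCommGroup F'] [NormedSpace ℝ F'] [FiniteDimensional ℝ F']
  {E' : M' → Type*} [TopologicalSpace (TotalSpace F' E')] [∀ y, AddCommGroup (E' y)]
  [∀ y, Module ℝ (E' y)] [∀ y, TopologicalSpace (E' y)] [FiberBundle F' E']
  [VectorBundle ℝ F' E'] [ContMDiffVectorBundle ∞ F' E' 𝓘(ℝ, B')]
  {A : LieAlgebroid B F E} {A' : LieAlgebroid B' F' E'} {q : SimpleQuotient B F E B' F' E'}

theorem SimpleQuotient.castFiber_apply {N : Type*} {V W : N → Type*} [∀ y, AddCommGroup (V y)]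
    [∀ y, Module ℝ (V y)] [∀ y, AddCommGroup (W y)] [∀ y, Module ℝ (W y)]
    (m : ∀ y, V y →ₗ[ℝ] W y) {y z : N} (h : y = z) (v : V y) :
    castFiber W h (m y v) = m z (castFiber V h v) := by
  subst h
  rfl

theorem SimpleQuotient.castFiber_symm_castFiber {N : Type*} {V : N → Type*}
    [∀ y, AddCommGroup (V y)] [∀ y, Module ℝ (V y)] {y z : N} (h : y = z) (v : V y) :
    castFiber V h.symm (castFiber V h v) = v := by
  subst h
  rfl

theorem SimpleQuotient.fiberIso_mk (x : M) (e : E x) :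
    q.fiberIso x ((q.K x).mkQ e) = q.map x e := rfl

theorem dirDeriv_eq_zero_of_eventually_const {f : M → ℝ} {x : M} {c : ℝ}
    (h : ∀ᶠ z in 𝓝 x, f z = c) (v : TangentSpace 𝓘(ℝ, B) x) : dirDeriv v f = 0 := by
  have h1 : f =ᶠ[𝓝 x] fun _ => c := h
  have h2 : mfderiv 𝓘(ℝ, B) 𝓘(ℝ, ℝ) (fun _ : M => c) x = 0 := mfderiv_const
  have h3 : (mfderiv 𝓘(ℝ, B) 𝓘(ℝ, ℝ) f x : B →L[ℝ] ℝ)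
      = (mfderiv 𝓘(ℝ, B) 𝓘(ℝ, ℝ) (fun _ : M => c) x : B →L[ℝ] ℝ) := h1.mfderiv_eq
  exact (DFunLike.congr_fun h3 v).trans (DFunLike.congr_fun h2 v)

/-- The morphism condition with one term on each side: the cutoffs are `1` near `x`, so their
derivatives drop out. -/
theorem SimpleQuotient.IsAlgebroidMorphism.map_bracket (hq : q.IsAlgebroidMorphism A A')
    {s t : Sec B F E} {s' t' : Sec B' F' E'} {φ ψ : C^∞⟮𝓘(ℝ, B), M; ℝ⟯} {x : M}
    (hφ : ∀ᶠ z in 𝓝 x, φ z = 1) (hψ : ∀ᶠ z in 𝓝 x, ψ z = 1)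
    (hs : ∀ z, q.map z (s z) = φ z • s' (q.base z))
    (ht : ∀ z, q.map z (t z) = ψ z • t' (q.base z)) :
    q.map x (A.bracket s t x) = A'.bracket s' t' (q.base x) := by
  have h := hq.bracket s t 1 1 (fun _ => φ) (fun _ => s') (fun _ => ψ) (fun _ => t')
    (fun z => by rw [Fin.sum_univ_one, hs]) (fun z => by rw [Fin.sum_univ_one, ht]) x
  simpa [dirDeriv_eq_zero_of_eventually_const hφ, dirDeriv_eq_zero_of_eventually_const hψ,
    hφ.self_of_nhds, hψ.self_of_nhds] using h

/-- Here `m` is a bare family of linear maps, so that the lemma can also serve to prove that `m` is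
smooth. -/
theorem SimpleQuotient.IsPushforward.onSec_eventuallyEq {k : ℕ} {μ : FormMap B F E k}
    {m : ∀ y, E' y →ₗ[ℝ] Alt B' k y}
    (hm : ∀ x (e : E x), pullAt q.base k x (m (q.base x) (q.map x e)) = μ.toLin x e)
    {s : Sec B F E} {s' : Sec B' F' E'} {φ : C^∞⟮𝓘(ℝ, B), M; ℝ⟯} {x : M}
    (hφ : ∀ᶠ z in 𝓝 x, φ z = 1) (hs : ∀ z, q.map z (s z) = φ z • s' (q.base z)) :
    ∀ᶠ z in 𝓝 x, μ.onSec s z = pullForm q.base (fun y => m y (s' y)) z := by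
  filter_upwards [hφ] with z hz
  rw [FormMap.onSec, ← hm, hs, hz, one_smul]
  rfl

theorem SimpleQuotient.IsAlgebroidMorphism.anchorSec_eventuallyEq
    (hq : q.IsAlgebroidMorphism A A')
    {s : Sec B F E} {s' : Sec B' F' E'} {φ : C^∞⟮𝓘(ℝ, B), M; ℝ⟯} {x : M}
    (hφ : ∀ᶠ z in 𝓝 x, φ z = 1) (hs : ∀ z, q.map z (s z) = φ z • s' (q.base z)) :
    ∀ᶠ z in 𝓝 x, mfderiv 𝓘(ℝ, B) 𝓘(ℝ, B') q.base z (A.anchorSec s z)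
      = A'.anchorSec s' (q.base z) := by
  filter_upwards [hφ] with z hz
  rw [LieAlgebroid.anchorSec, ← hq.anchor, hs, hz, one_smul]
  rfl

/-- The quotient of an IM 2-form is an IM 2-form. -/
theorem IsIM.of_isPushforward {μ : FormMap B F E 1} {η : FormMap B F E 2} (hIM : IsIM A μ η)
    (hq : q.IsAlgebroidMorphism A A') {μ' : FormMap B' F' E' 1} {η' : FormMap B' F' E' 2}
    (hμ : q.IsPushforward μ μ') (hη : q.IsPushforward η η') : IsIM A' μ' η' := by
  have key : ∀ (s' t' : Sec B' F' E') (y : M'),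
      contract (A'.anchorSec s' y) (μ'.onSec t' y) = -contract (A'.anchorSec t' y) (μ'.onSec s' y) ∧
      μ'.onSec (A'.bracket s' t') y = lieDer (A'.anchorSec s') (μ'.onSec t') y
        - contract (A'.anchorSec t' y) (extD (μ'.onSec s') y)
        - contract (A'.anchorSec t' y) (η'.onSec s' y) ∧
      η'.onSec (A'.bracket s' t') y = lieDer (A'.anchorSec s') (η'.onSec t') y
        - contract (A'.anchorSec t' y) (extD (η'.onSec s') y) := by
    intro s' t' y
    obtain ⟨x, rfl⟩ := q.base_surjective y
    obtain ⟨φ, s, hφ, hs⟩ := q.exists_lift s' x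
    obtain ⟨ψ, t, hψ, ht⟩ := q.exists_lift t' x
    have hb := hq.map_bracket hφ hψ hs ht
    have hf := q.base_smooth.contMDiffAt (x := x)
    have hXs := hq.anchorSec_eventuallyEq hφ hs
    have hXt := hq.anchorSec_eventuallyEq hψ ht
    have hms := SimpleQuotient.IsPushforward.onSec_eventuallyEq hμ hφ hs
    have hmt := SimpleQuotient.IsPushforward.onSec_eventuallyEq hμ hψ ht
    have hes := SimpleQuotient.IsPushforward.onSec_eventuallyEq hη hφ hs
    have het := SimpleQuotient.IsPushforward.onSec_eventuallyEq hη hψ ht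
    have sm : ∀ {k : ℕ} (m : FormMap B' F' E' k) (r : Sec B' F' E'),
        SmoothFormAt (fun y => m.toLin y (r y)) (q.base x) :=
      fun m r => isSmoothForm_iff.1 (m.smooth r) _
    have hinj := fun k => pullAt_injective (q.base_submersion x) k
    have hc : ∀ {k : ℕ} {r : Sec B F E} {r' : Sec B' F' E'}
        (_ : mfderiv 𝓘(ℝ, B) 𝓘(ℝ, B') q.base x (A.anchorSec r x) = A'.anchorSec r' (q.base x))
        (α : Alt B' (k + 1) (q.base x)),
        contract (A.anchorSec r x) (pullAt q.base (k + 1) x α)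
          = pullAt q.base k x (contract (A'.anchorSec r' (q.base x)) α) := by
      intro k r r' h α
      rw [contract_pullAt, h]
    have hdm := (extD_congr hms).trans (extD_pullForm hf (sm μ' s'))
    have hde := (extD_congr hes).trans (extD_pullForm hf (sm η' s'))
    have hlm := lieDer_pullForm hf hXs (A'.contMDiff_anchorSec s' _) hmt (sm μ' t')
    have hle := lieDer_pullForm hf hXs (A'.contMDiff_anchorSec s' _) het (sm η' t')
    -- The three equations are identities of forms of degrees 0, 1 and 2 at `q.base x`. After
    -- pullback to `x` they become the IM equations of the lifts `s`, `t`.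
    refine ⟨hinj 0 ?_, hinj 1 ?_, hinj 2 ?_⟩
    · have h := hIM.skew s t x
      rw [hmt.self_of_nhds, hms.self_of_nhds, pullForm, pullForm, hc hXs.self_of_nhds,
        hc hXt.self_of_nhds] at h
      rw [map_neg]
      exact h
    · have h := hIM.bracket_mu s t x
      rw [hlm, hdm, hes.self_of_nhds, pullForm, hc hXt.self_of_nhds,
        hc hXt.self_of_nhds, FormMap.onSec, ← hμ, hb] at h
      rw [map_sub, map_sub]
      exact h
    · have h := hIM.bracket_eta s t x
      rw [hle, hde, hc hXt.self_of_nhds, FormMap.onSec, ← hη, hb] at h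
      rw [map_sub]
      exact h
  exact ⟨fun s t y => (key s t y).1, fun s t y => (key s t y).2.1, fun s t y => (key s t y).2.2⟩

/-- A family of linear maps on the fibers of `E'` which is compatible with `μ` is a smooth
quotient of `μ`. -/
theorem SimpleQuotient.exists_isPushforward_of_linearMap {k : ℕ} {μ : FormMap B F E k}
    (m : ∀ y, E' y →ₗ[ℝ] Alt B' k y)
    (hm : ∀ x (e : E x), pullAt q.base k x (m (q.base x) (q.map x e)) = μ.toLin x e) :
    ∃ μ' : FormMap B' F' E' k, μ'.toLin = m ∧ q.IsPushforward μ μ' := by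
  refine ⟨⟨m, fun s' => isSmoothForm_iff.2 fun y => ?_⟩, rfl, hm⟩
  obtain ⟨x, rfl⟩ := q.base_surjective y
  obtain ⟨φ, s, hφ, hs⟩ := q.exists_lift s' x
  exact smoothFormAt_of_pullForm q.base_smooth (q.base_submersion x)
    (isSmoothForm_iff.1 (μ.smooth s) x) (SimpleQuotient.IsPushforward.onSec_eventuallyEq hm hφ hs)

/-- If `μ` has a quotient then it takes invariant sections to basic forms. -/
theorem SimpleQuotient.IsPushforward.isBasicForm {k : ℕ} {μ : FormMap B F E k}
    {μ' : FormMap B' F' E' k} (hμ : q.IsPushforward μ μ') {s : Sec B F E} (hs : q.IsInvariant s) :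
    IsBasicForm (B' := B') q.base (μ.onSec s) := by
  -- Invariance says that `q (s x)` is constant along each fiber of `q.base`, so it defines a
  -- set-theoretic section `s'` of `E'`.
  have h : ∀ y, ∃ e' : E' y, ∀ x (h : q.base x = y),
      SimpleQuotient.castFiber E' h (q.map x (s x)) = e' := by
    intro y
    obtain ⟨x₀, rfl⟩ := q.base_surjective y
    refine ⟨q.map x₀ (s x₀), fun x h => ?_⟩
    have h1 := congrArg (q.fiberIso x₀) (hs x x₀ h)
    rw [SimpleQuotient.Δ, LinearEquiv.trans_apply, LinearEquiv.trans_apply,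
      LinearEquiv.apply_symm_apply] at h1
    exact h1
  choose s' hs' using h
  have h1 : μ.onSec s = pullForm q.base (fun y => μ'.toLin y (s' y)) := by
    funext x
    rw [FormMap.onSec, ← hμ, pullForm, ← hs' (q.base x) x rfl]
    rfl
  -- Smoothness of `s'` need not be known: the form on `M'` is smooth because its pullback `μ.onSec
  -- s` is.
  refine ⟨_, isSmoothForm_iff.2 fun y => ?_, h1⟩
  obtain ⟨x, rfl⟩ := q.base_surjective y
  exact smoothFormAt_of_pullForm q.base_smooth (q.base_submersion x)
    (isSmoothForm_iff.1 (μ.smooth s) x) (Filter.Eventually.of_forall fun z => congrFun h1 z)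

/-- Equivariance of the induced map `μ̄` on `E / K`. -/
theorem SimpleQuotient.IsPushforward.equivariant {μ : FormMap B F E 1} {μ' : FormMap B' F' E' 1}
    (hμ : q.IsPushforward μ μ') (hK : ∀ x, q.K x ≤ LinearMap.ker (μ.toLin x))
    (hAnn : ∀ x (e : E x), μ.toLin x e ∈ q.ann x) (x y : M) (h : q.base x = q.base y)
    (e : E y ⧸ q.K y) :
    q.muBar μ hK hAnn x (q.Δ x y h e) = q.conormalΔ x y h (q.muBar μ hK hAnn y e) := by
  obtain ⟨e, rfl⟩ := (q.K y).mkQ_surjective e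
  obtain ⟨e₁, he₁⟩ := q.map_surjective x (SimpleQuotient.castFiber E' h.symm (q.map y e))
  have h1 : q.Δ x y h ((q.K y).mkQ e) = (q.K x).mkQ e₁ := by
    apply (q.fiberIso x).injective
    rw [SimpleQuotient.Δ, LinearEquiv.trans_apply, LinearEquiv.trans_apply,
      LinearEquiv.apply_symm_apply]
    exact he₁.symm
  have h2 : q.muBar μ hK hAnn y ((q.K y).mkQ e)
      = q.conormalIso y (μ'.toLin (q.base y) (q.map y e)) :=
    Subtype.ext (hμ y e).symm
  rw [h1, h2, SimpleQuotient.conormalΔ, LinearEquiv.trans_apply, LinearEquiv.trans_apply,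
    LinearEquiv.symm_apply_apply, SimpleQuotient.castFiber_apply (fun y => μ'.toLin y), ← he₁]
  exact Subtype.ext (hμ x e₁).symm

/-- An equivariant map `μ̄` has a quotient. -/
theorem SimpleQuotient.exists_isPushforward_of_equivariant {μ : FormMap B F E 1}
    (hK : ∀ x, q.K x ≤ LinearMap.ker (μ.toLin x))
    (hAnn : ∀ x (e : E x), μ.toLin x e ∈ q.ann x)
    (heq : ∀ (x y : M) (h : q.base x = q.base y) (e : E y ⧸ q.K y),
      q.muBar μ hK hAnn x (q.Δ x y h e) = q.conormalΔ x y h (q.muBar μ hK hAnn y e)) :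
    ∃ μ' : FormMap B' F' E' 1, q.IsPushforward μ μ' := by
  have h : ∀ y, ∃ m : E' y →ₗ[ℝ] Alt B' 1 y, ∀ x (h : q.base x = y) (e : E x),
      pullAt q.base 1 x (SimpleQuotient.castFiber (fun z : M' => Alt B' 1 z) h.symm
        (m (SimpleQuotient.castFiber E' h (q.map x e)))) = μ.toLin x e := by
    intro y
    obtain ⟨x₀, rfl⟩ := q.base_surjective y
    -- The map is read off from `μ̄` at one chosen point `x₀` over `y`; equivariance shows that
    -- every other point of the fiber gives the same map.
    refine ⟨(q.conormalIso x₀).symm.toLinearMap ∘ₗ q.muBar μ hK hAnn x₀ ∘ₗ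
      (q.fiberIso x₀).symm.toLinearMap, fun x h e => ?_⟩
    have h1 := heq x x₀ h ((q.fiberIso x₀).symm (SimpleQuotient.castFiber E' h (q.map x e)))
    have h2 : q.Δ x x₀ h ((q.fiberIso x₀).symm (SimpleQuotient.castFiber E' h (q.map x e)))
        = (q.K x).mkQ e := by
      apply (q.fiberIso x).injective
      rw [SimpleQuotient.Δ, LinearEquiv.trans_apply, LinearEquiv.trans_apply,
        LinearEquiv.apply_symm_apply, LinearEquiv.apply_symm_apply,
        SimpleQuotient.castFiber_symm_castFiber, SimpleQuotient.fiberIso_mk]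
    rw [h2] at h1
    exact (congrArg Subtype.val h1).symm
  choose m hm using h
  obtain ⟨μ', -, h⟩ := SimpleQuotient.exists_isPushforward_of_linearMap m
    (fun x e => hm (q.base x) x rfl e)
  exact ⟨μ', h⟩

omit [FiniteDimensional ℝ B] [T2Space M] [ContMDiffVectorBundle ∞ F E 𝓘(ℝ, B)]
  [FiniteDimensional ℝ B'] [T2Space M'] [FiniteDimensional ℝ F']
  [ContMDiffVectorBundle ∞ F' E' 𝓘(ℝ, B')] in
theorem SimpleQuotient.finrank_K (q : SimpleQuotient B F E B' F' E') (x : M) :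
    (Module.finrank ℝ (q.K x) : ℤ)
      = Module.finrank ℝ (E x) - Module.finrank ℝ (E' (q.base x)) := by
  have : FiniteDimensional ℝ (E x) := VectorBundle.finiteDimensional ℝ F E x
  have h := LinearMap.finrank_range_add_finrank_ker (q.map x)
  rw [LinearMap.range_eq_top.2 (q.map_surjective x), finrank_top] at h
  rw [SimpleQuotient.K]
  omega

theorem IsTwistedBy.pullForm {η : FormMap B F E 2} {η' : FormMap B' F' E' 2}
    (hq : q.IsAlgebroidMorphism A A') (hη : q.IsPushforward η η') {χ' : ∀ y : M', Alt B' 3 y}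
    (h : IsTwistedBy A' η' χ') : IsTwistedBy A η (pullForm q.base χ') := by
  intro x e
  rw [← hη, h, AlgebroidQuotient.pullForm, contract_pullAt, hq.anchor, map_neg]

theorem IsTwistedBy.of_pullForm {η : FormMap B F E 2} {η' : FormMap B' F' E' 2}
    (hq : q.IsAlgebroidMorphism A A') (hη : q.IsPushforward η η') {χ' : ∀ y : M', Alt B' 3 y}
    (h : IsTwistedBy A η (AlgebroidQuotient.pullForm q.base χ')) : IsTwistedBy A' η' χ' := by
  intro y e'
  obtain ⟨x, rfl⟩ := q.base_surjective y
  obtain ⟨e, rfl⟩ := q.map_surjective x e'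
  apply pullAt_injective (q.base_submersion x) 2
  rw [hη, h, AlgebroidQuotient.pullForm, contract_pullAt, hq.anchor, map_neg]

theorem SimpleQuotient.IsPushforward.K_le_ker {k : ℕ} {μ : FormMap B F E k}
    {μ' : FormMap B' F' E' k} (hμ : q.IsPushforward μ μ') (x : M) :
    q.K x ≤ LinearMap.ker (μ.toLin x) := by
  intro e he
  rw [LinearMap.mem_ker, ← hμ, LinearMap.mem_ker.1 he, map_zero, map_zero]

theorem SimpleQuotient.IsPushforward.mem_ker_iff {k : ℕ} {μ : FormMap B F E k}
    {μ' : FormMap B' F' E' k} (hμ : q.IsPushforward μ μ') (x : M) (e : E x) :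
    e ∈ LinearMap.ker (μ.toLin x) ↔ q.map x e ∈ LinearMap.ker (μ'.toLin (q.base x)) := by
  rw [LinearMap.mem_ker, LinearMap.mem_ker, ← hμ,
    map_eq_zero_iff _ (pullAt_injective (q.base_submersion x) k)]

/-- By `hk` the subspace on the right is the preimage under the surjection `q` of `Ker μ' ∩ Ker ρ'`,
so it equals `Ker q` exactly when that intersection is zero. The rank conditions match by
rank–nullity. -/
theorem SimpleQuotient.IsPushforward.isWeaklyNondegenerate_iff {μ : FormMap B F E 1}
    {μ' : FormMap B' F' E' 1} (hq : q.IsAlgebroidMorphism A A') (hμ : q.IsPushforward μ μ') :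
    IsWeaklyNondegenerate A' μ' ↔
      (∀ x, q.K x = LinearMap.ker (μ.toLin x) ⊓
        (LinearMap.ker (mfderiv 𝓘(ℝ, B) 𝓘(ℝ, B') q.base x).toLinearMap).comap (A.anchor x)) ∧
      ∀ x, (Module.finrank ℝ (q.K x) : ℤ) = Module.finrank ℝ (E x) - Module.finrank ℝ B' := by
  have hk : ∀ x (e : E x), e ∈ LinearMap.ker (μ.toLin x) ⊓
      (LinearMap.ker (mfderiv 𝓘(ℝ, B) 𝓘(ℝ, B') q.base x).toLinearMap).comap (A.anchor x) ↔
      q.map x e ∈ LinearMap.ker (μ'.toLin (q.base x)) ⊓ LinearMap.ker (A'.anchor (q.base x)) := by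
    intro x e
    rw [Submodule.mem_inf, Submodule.mem_inf, hμ.mem_ker_iff, Submodule.mem_comap,
      LinearMap.mem_ker, LinearMap.mem_ker (f := A'.anchor (q.base x)), hq.anchor]
    rfl
  constructor
  · intro h
    refine ⟨fun x => ?_, fun x => ?_⟩
    · ext e
      rw [hk, (h (q.base x)).2, Submodule.mem_bot]
      exact LinearMap.mem_ker
    · rw [q.finrank_K, (h (q.base x)).1]
  · rintro ⟨h1, h2⟩ y
    obtain ⟨x, rfl⟩ := q.base_surjective y
    refine ⟨?_, ?_⟩
    · have h3 := h2 x
      rw [q.finrank_K] at h3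
      omega
    · rw [eq_bot_iff]
      intro e' he'
      obtain ⟨e, rfl⟩ := q.map_surjective x e'
      rw [← hk, ← h1] at he'
      exact (Submodule.mem_bot ℝ).2 (LinearMap.mem_ker.1 he')

end Quotient

/-! ### Lagrangian subspaces -/

section Lagrangian

variable {B : Type*} [NormedAddCommGroup B] [NormedSpace ℝ B] [FiniteDimensional ℝ B]
  {M : Type*} [TopologicalSpace M] [ChartedSpace B M]

/-- Evaluation of a 1-form on a vector, as a linear equivalence with the dual space. -/
noncomputable def oneFormEquiv (V : Type*) [NormedAddCommGroup V] [NormedSpace ℝ V] :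
    (V [⋀^Fin 1]→L[ℝ] ℝ) ≃ₗ[ℝ] (V →L[ℝ] ℝ) :=
  LinearEquiv.symm
    { ContinuousAlternatingMap.ofSubsingleton ℝ V ℝ (0 : Fin 1) with
      map_add' := fun _ _ => rfl
      map_smul' := fun _ _ => rfl }

/-- The symmetric pairing on `V ⊕ V*`. -/
noncomputable def pairingForm (V : Type*) [NormedAddCommGroup V] [NormedSpace ℝ V] :
    LinearMap.BilinForm ℝ (V × (V [⋀^Fin 1]→L[ℝ] ℝ)) :=
  LinearMap.mk₂ ℝ (fun p r => oneFormEquiv V p.2 r.1 + oneFormEquiv V r.2 p.1)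
    (fun p p' r => by
      simp only [Prod.fst_add, Prod.snd_add, map_add, _root_.add_apply]
      ring)
    (fun c p r => by
      simp only [Prod.smul_fst, Prod.smul_snd, map_smul, _root_.smul_apply, smul_eq_mul]
      ring)
    (fun p r r' => by
      simp only [Prod.fst_add, Prod.snd_add, map_add, _root_.add_apply]
      ring)
    (fun c p r => by
      simp only [Prod.smul_fst, Prod.smul_snd, map_smul, _root_.smul_apply, smul_eq_mul]
      ring)

theorem pairingForm_isSymm (V : Type*) [NormedAddCommGroup V] [NormedSpace ℝ V] :
    (pairingForm V).IsSymm :=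
  ⟨fun _ _ => add_comm _ _⟩

theorem pairingForm_nondegenerate (V : Type*) [NormedAddCommGroup V] [NormedSpace ℝ V] :
    (pairingForm V).Nondegenerate := by
  refine (pairingForm_isSymm V).isRefl.nondegenerate_iff_separatingLeft.2 fun p hp => ?_
  have h1 : p.1 = 0 := SeparatingDual.eq_zero_of_forall_dual_eq_zero (R := ℝ) fun ℓ => by
    have h := hp (0, (oneFormEquiv V).symm ℓ)
    simpa [pairingForm] using h
  have h2 : p.2 = 0 := (oneFormEquiv V).map_eq_zero_iff.1 (by
    ext v
    have h := hp (v, 0)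
    simpa [pairingForm] using h)
  exact Prod.ext h1 h2

/-- An isotropic subspace of `TₓM ⊕ T*ₓM` of the dimension of `M` is Lagrangian. -/
theorem mem_iff_pairing_eq_zero {x : M}
    {L : Submodule ℝ (TangentSpace 𝓘(ℝ, B) x × Alt B 1 x)}
    (hdim : Module.finrank ℝ L = Module.finrank ℝ B)
    (hL : ∀ p ∈ L, ∀ r ∈ L, pairing p r = 0) (p : TangentSpace 𝓘(ℝ, B) x × Alt B 1 x) :
    p ∈ L ↔ ∀ r ∈ L, pairing p r = 0 := by
  have hfin := finiteDimensional_continuousAlternatingMap B 1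
  let L₀ : Submodule ℝ (B × (B [⋀^Fin 1]→L[ℝ] ℝ)) := L
  have hle : L₀ ≤ (pairingForm B).orthogonal L₀ := fun p hp r hr => hL r hr p hp
  have h1 : Module.finrank ℝ (B [⋀^Fin 1]→L[ℝ] ℝ) = Module.finrank ℝ B := by
    rw [(oneFormEquiv B).finrank_eq,
      ← (LinearMap.toContinuousLinearMap (𝕜 := ℝ) (E := B) (F' := ℝ)).finrank_eq]
    exact Subspace.dual_finrank_eq
  -- With `n = dim B`, the orthogonal of `L₀` has dimension `2n - n = n`, so the inclusion `hle` is
  -- an equality.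
  have h2 := LinearMap.BilinForm.finrank_orthogonal (pairingForm_nondegenerate B) L₀
  have h0 : Module.finrank ℝ L₀ = Module.finrank ℝ B := hdim
  rw [Module.finrank_prod, h1, h0, Nat.add_sub_cancel] at h2
  have h3 : L₀ = (pairingForm B).orthogonal L₀ :=
    Submodule.eq_of_le_of_finrank_eq hle (by rw [h2, h0])
  refine ⟨fun hp r hr => hL p hp r hr, fun h => ?_⟩
  have h4 : p ∈ (pairingForm B).orthogonal L₀ := fun r hr =>
    ((pairingForm_isSymm B).eq r p).trans (h r hr)
  rw [← h3] at h4
  exact h4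

end Lagrangian

/-! ### Dirac structures defined by IM 2-forms -/

section Dirac

variable {B : Type*} [NormedAddCommGroup B] [NormedSpace ℝ B] [FiniteDimensional ℝ B]
  {M : Type*} [TopologicalSpace M] [T2Space M] [ChartedSpace B M] [IsManifold 𝓘(ℝ, B) ∞ M]
  {F : Type*} [NormedAddCommGroup F] [NormedSpace ℝ F] [FiniteDimensional ℝ F]
  {E : M → Type*} [TopologicalSpace (TotalSpace F E)] [∀ x, AddCommGroup (E x)]
  [∀ x, Module ℝ (E x)] [∀ x, TopologicalSpace (E x)] [FiberBundle F E] [VectorBundle ℝ F E]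
  [ContMDiffVectorBundle ∞ F E 𝓘(ℝ, B)]
  {A : LieAlgebroid B F E} {μ : FormMap B F E 1} {η : FormMap B F E 2}

/-- The vector `(X, α)` over the point of coordinate `y` in the chart at `x₀`, in coordinates. -/
noncomputable def coordMap (x₀ : M) (y : B) :
    (TangentSpace 𝓘(ℝ, B) ((extChartAt 𝓘(ℝ, B) x₀).symm y) ×
      Alt B 1 ((extChartAt 𝓘(ℝ, B) x₀).symm y)) →ₗ[ℝ] B × (B [⋀^Fin 1]→L[ℝ] ℝ) where
  toFun p := ((mfderiv 𝓘(ℝ, B) 𝓘(ℝ, B) (extChartAt 𝓘(ℝ, B) x₀)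
    ((extChartAt 𝓘(ℝ, B) x₀).symm y) : B →L[ℝ] B) p.1,
    p.2.compContinuousLinearMap (mfderiv 𝓘(ℝ, B) 𝓘(ℝ, B) (extChartAt 𝓘(ℝ, B) x₀).symm y))
  map_add' p r := Prod.ext (map_add (mfderiv 𝓘(ℝ, B) 𝓘(ℝ, B) (extChartAt 𝓘(ℝ, B) x₀)
    ((extChartAt 𝓘(ℝ, B) x₀).symm y) : B →L[ℝ] B) p.1 r.1) rfl
  map_smul' c p := Prod.ext (map_smul (mfderiv 𝓘(ℝ, B) 𝓘(ℝ, B) (extChartAt 𝓘(ℝ, B) x₀)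
    ((extChartAt 𝓘(ℝ, B) x₀).symm y) : B →L[ℝ] B) c p.1) rfl

theorem coordMap_injective {x₀ : M} {y : B} (hy : y ∈ (extChartAt 𝓘(ℝ, B) x₀).target) :
    Function.Injective (coordMap x₀ y) := by
  rw [← LinearMap.ker_eq_bot, LinearMap.ker_eq_bot']
  intro p hp
  have h1 : p.1 = 0 := by
    have h := mfderiv_extChartAt_comp_symm hy p.1
    have h' : (mfderiv 𝓘(ℝ, B) 𝓘(ℝ, B) (extChartAt 𝓘(ℝ, B) x₀)
      ((extChartAt 𝓘(ℝ, B) x₀).symm y) : B →L[ℝ] B) p.1 = 0 := congrArg Prod.fst hp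
    let T : B →L[ℝ] B := mfderiv 𝓘(ℝ, B) 𝓘(ℝ, B) (extChartAt 𝓘(ℝ, B) x₀).symm y
    exact h.symm.trans ((congrArg T h').trans (map_zero T))
  refine Prod.ext h1 ?_
  ext v
  have h := DFunLike.congr_fun (congrArg Prod.snd hp) (fun i => (mfderiv 𝓘(ℝ, B) 𝓘(ℝ, B)
    (extChartAt 𝓘(ℝ, B) x₀) ((extChartAt 𝓘(ℝ, B) x₀).symm y) : B →L[ℝ] B) (v i))
  refine Eq.trans ?_ h
  exact congrArg p.2 (funext fun i => (mfderiv_extChartAt_comp_symm hy (v i)).symm)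

theorem contDiffAt_coordMap {x₀ : M} {X : ∀ x : M, TangentSpace 𝓘(ℝ, B) x}
    {α : ∀ x : M, Alt B 1 x}
    (hX : ContMDiffAt 𝓘(ℝ, B) (𝓘(ℝ, B).prod 𝓘(ℝ, B)) ∞
      (fun x => (⟨x, X x⟩ : TangentBundle 𝓘(ℝ, B) M)) x₀) (hα : SmoothFormAt α x₀) :
    ContDiffAt ℝ ∞ (fun y => coordMap x₀ y (X ((extChartAt 𝓘(ℝ, B) x₀).symm y),
      α ((extChartAt 𝓘(ℝ, B) x₀).symm y))) (extChartAt 𝓘(ℝ, B) x₀ x₀) :=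
  (contDiffAt_vecRep hX).prodMk hα

/-- Smooth curves in the span of a smooth independent family have smooth coefficients. -/
theorem exists_contDiffAt_coefficients {X V : Type*} [NormedAddCommGroup X] [NormedSpace ℝ X]
    [NormedAddCommGroup V] [NormedSpace ℝ V] [FiniteDimensional ℝ V] {n : ℕ} {x : X}
    {N : Fin n → X → V} {v : X → V} (hN : ∀ i, ContDiffAt ℝ ∞ (N i) x) (hv : ContDiffAt ℝ ∞ v x)
    (hli : LinearIndependent ℝ fun i => N i x) :
    ∃ c : X → Fin n → ℝ, ContDiffAt ℝ ∞ c x ∧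
      ∀ᶠ y in 𝓝 x, ∀ d : Fin n → ℝ, v y = ∑ i, d i • N i y → d = c y := by
  let b := Pi.basisFun ℝ (Fin n)
  -- Projecting by a left inverse of the combination map at `x` turns `v y = ∑ i, d i • N i y` into
  -- a square system `G y d = P (v y)`. Since `G x = 1`, it is invertible nearby, with smooth
  -- inverse.
  obtain ⟨P₀, hP₀⟩ := LinearMap.exists_leftInverse_of_injective
    (Fintype.linearCombination ℝ fun i => N i x)
    (LinearMap.ker_eq_bot.2 hli.fintypeLinearCombination_injective)
  let P : V →L[ℝ] (Fin n → ℝ) := LinearMap.toContinuousLinearMap P₀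
  let G : X → (Fin n → ℝ) →L[ℝ] (Fin n → ℝ) := fun y =>
    ∑ i, (ContinuousLinearMap.proj i : (Fin n → ℝ) →L[ℝ] ℝ).smulRight (P (N i y))
  have hGapp : ∀ y d, G y d = P (∑ i, d i • N i y) := by
    intro y d
    simp [G, map_sum]
  have hG : ContDiffAt ℝ ∞ G x := ContDiffAt.sum fun i _ =>
    contDiffAt_const.smulRight (P.contDiff.contDiffAt.comp x (hN i))
  have hGx : G x = 1 := by
    ext1 d
    rw [hGapp]
    exact LinearMap.congr_fun hP₀ d
  have hunit : IsUnit (G x) := hGx ▸ isUnit_one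
  have hinv : ContDiffAt ℝ ∞ (fun y => Ring.inverse (G y)) x := by
    obtain ⟨u, hu⟩ := hunit
    have h := contDiffAt_ringInverse ℝ (n := ∞) u
    rw [hu] at h
    exact h.comp x hG
  refine ⟨fun y => Ring.inverse (G y) (P (v y)),
    hinv.clm_apply (P.contDiff.contDiffAt.comp x hv), ?_⟩
  have hev : ∀ᶠ y in 𝓝 x, IsUnit (G y) := by
    have ho : IsOpen {T : (Fin n → ℝ) →L[ℝ] (Fin n → ℝ) | IsUnit T} := Units.isOpen
    exact hG.continuousAt.eventually (ho.mem_nhds hunit)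
  filter_upwards [hev] with y hy d hd
  rw [hd, ← hGapp]
  have h := Ring.inverse_mul_cancel _ hy
  exact (DFunLike.congr_fun h d).symm

/-- Smooth sections of the image of an injective `(ρ, μ)` come from smooth sections. -/
theorem exists_sec_of_mem_range
    (hinj : ∀ x, Function.Injective ((A.anchor x).prod (μ.toLin x)))
    {X : Cₛ^∞⟮𝓘(ℝ, B); B, fun x : M => TangentSpace 𝓘(ℝ, B) x⟯} {α : ∀ x : M, Alt B 1 x}
    (hα : IsSmoothForm α)
    (h : ∀ x, (X x, α x) ∈ LinearMap.range ((A.anchor x).prod (μ.toLin x))) :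
    ∃ s : Sec B F E, (∀ x, A.anchorSec s x = X x) ∧ μ.onSec s = α := by
  have hfin := finiteDimensional_continuousAlternatingMap B 1
  choose σ hσ using h
  have hsm : ContMDiff 𝓘(ℝ, B) (𝓘(ℝ, B).prod 𝓘(ℝ, F)) ∞
      (fun x => (⟨x, σ x⟩ : TotalSpace F E)) := by
    intro x₀
    obtain ⟨t, ht⟩ := exists_sec_frame (B := B) (F := F) (E := E) x₀
    let φ := extChartAt 𝓘(ℝ, B) x₀
    -- Injectivity of `(ρ, μ)` keeps the image of the frame independent at `x₀`, so the coefficients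
    -- of `σ` in the frame can be recovered smoothly from `(X, α)`.
    obtain ⟨c, hc, hce⟩ := exists_contDiffAt_coefficients (x := φ x₀)
      (N := fun i y => coordMap x₀ y (A.anchorSec (t i) (φ.symm y), μ.onSec (t i) (φ.symm y)))
      (v := fun y => coordMap x₀ y (X (φ.symm y), α (φ.symm y)))
      (fun i => contDiffAt_coordMap (A.contMDiff_anchorSec (t i) x₀)
        (isSmoothForm_iff.1 (μ.smooth (t i)) x₀))
      (contDiffAt_coordMap (X.contMDiff x₀) (isSmoothForm_iff.1 hα x₀))
      (by
        have h1 := ht.self_of_nhds.1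
        have h2 : φ.symm (φ x₀) = x₀ := extChartAt_to_inv x₀
        rw [← h2] at h1
        exact (h1.map' _ (LinearMap.ker_eq_bot.2 (hinj _))).map' _
          (LinearMap.ker_eq_bot.2 (coordMap_injective (mem_extChartAt_target x₀))))
    have hev : ∀ᶠ z in 𝓝 x₀, σ z = ∑ i, c (φ z) i • t i z := by
      filter_upwards [ht, (continuousAt_extChartAt x₀).eventually hce,
        extChartAt_source_mem_nhds (I := 𝓘(ℝ, B)) x₀] with z hz1 hz2 hz3
      have hz : σ z ∈ Submodule.span ℝ (Set.range fun i => t i z) := hz1.2 ▸ Submodule.mem_top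
      obtain ⟨d, hd⟩ := (Submodule.mem_span_range_iff_exists_fun ℝ).1 hz
      have hdc : d = c (φ z) := by
        refine hz2 d ?_
        have hleft : φ.symm (φ z) = z := φ.left_inv hz3
        -- Stated for a variable `w` because the identity is needed over `φ.symm (φ z)`, which
        -- equals `z` only propositionally.
        have hsum : ∀ w, w = z → (X w, α w) = ∑ i, d i • (A.anchorSec (t i) w, μ.onSec (t i) w) := by
          rintro w rfl
          rw [← hσ, ← hd, map_sum]
          exact Finset.sum_congr rfl fun i _ => map_smul _ _ _
        have h3 := congrArg (coordMap x₀ (φ z)) (hsum _ hleft)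
        rw [map_sum] at h3
        exact h3.trans (Finset.sum_congr rfl fun i _ => map_smul _ _ _)
      rw [← hd, hdc]
    have hcs : ∀ i, ContMDiffAt 𝓘(ℝ, B) 𝓘(ℝ, ℝ) ∞ (fun z => c (φ z) i) x₀ := fun i =>
      ContMDiffAt.comp x₀ (contDiffAt_pi.1 hc i).contMDiffAt contMDiffAt_extChartAt
    have hsum : ContMDiffAt 𝓘(ℝ, B) (𝓘(ℝ, B).prod 𝓘(ℝ, F)) ∞
        (fun z => (⟨z, ∑ i, c (φ z) i • t i z⟩ : TotalSpace F E)) x₀ :=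
      ContMDiffAt.sum_section fun i _ => (hcs i).smul_section (t i).contMDiff.contMDiffAt
    refine hsum.congr_of_eventuallyEq ?_
    filter_upwards [hev] with z hz
    rw [hz]
  refine ⟨⟨σ, hsm⟩, fun x => congrArg Prod.fst (hσ x), funext fun x => congrArg Prod.snd (hσ x)⟩

theorem IsWeaklyNondegenerate.injective (h : IsWeaklyNondegenerate A μ) (x : M) :
    Function.Injective ((A.anchor x).prod (μ.toLin x)) := by
  rw [← LinearMap.ker_eq_bot, LinearMap.ker_prod, inf_comm]
  exact (h x).2

/-- For a twisted IM 2-form, `(ρ, μ)` takes the bracket to the Courant bracket. -/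
theorem IsIM.prod_bracket (hIM : IsIM A μ η) {χ : ∀ x : M, Alt B 3 x} (hχ : IsTwistedBy A η χ)
    (s t : Sec B F E) (x : M) :
    (A.anchorSec (A.bracket s t) x, μ.onSec (A.bracket s t) x)
      = courant χ (A.anchorSec s) (μ.onSec s) (A.anchorSec t) (μ.onSec t) x := by
  refine Prod.ext (A.anchor_bracket s t x) ?_
  have h := hIM.bracket_mu s t x
  -- The sign in `η_χ = -i_ρ χ` turns `-i_{ρ(t)} η(s)` into `+χ(ρ(s), ρ(t), ·)`.
  rw [h, FormMap.onSec, hχ, contract_neg_right, sub_neg_eq_add]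
  rfl

theorem IsIM.pairing_eq_zero (hIM : IsIM A μ η) (x : M) (e f : E x) :
    pairing (A.anchor x e, μ.toLin x e) (A.anchor x f, μ.toLin x f) = 0 := by
  obtain ⟨s, rfl⟩ := exists_sec_eq (B := B) (F := F) x e
  obtain ⟨t, rfl⟩ := exists_sec_eq (B := B) (F := F) x f
  -- The skewness equation is between 0-forms; evaluation on the empty tuple gives real numbers.
  have h := DFunLike.congr_fun (hIM.skew s t x) ![]
  have h0 : ∀ (v : TangentSpace 𝓘(ℝ, B) x) (α : Alt B 1 x),
      contract v α ![] = α (fun _ => v) := by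
    intro v α
    refine congrArg α (funext fun i => ?_)
    rw [Subsingleton.elim (α := Fin 1) i 0]
    rfl
  have h1 : μ.toLin x (t x) (fun _ => A.anchor x (s x))
      = -μ.toLin x (s x) (fun _ => A.anchor x (t x)) :=
    (h0 _ _).symm.trans (h.trans (congrArg Neg.neg (h0 _ _)))
  change μ.toLin x (s x) (fun _ => A.anchor x (t x))
    + μ.toLin x (t x) (fun _ => A.anchor x (s x)) = 0
  rw [h1]
  exact add_neg_cancel _

/-- The image of `(ρ, μ)`, for a weakly non-degenerate twisted IM 2-form, is a twisted Dirac
structure. -/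
theorem IsIM.isDirac_range (hIM : IsIM A μ η) {χ : ∀ x : M, Alt B 3 x} (hχ : IsTwistedBy A η χ)
    (hnd : IsWeaklyNondegenerate A μ) :
    IsDirac χ fun x => LinearMap.range ((A.anchor x).prod (μ.toLin x)) where
  subbundle x₀ := by
    obtain ⟨t, ht⟩ := exists_sec_frame (B := B) (F := F) (E := E) x₀
    refine ⟨_, fun i => ⟨A.anchorSec (t i), A.contMDiff_anchorSec (t i)⟩, fun i => μ.onSec (t i),
      fun i => μ.smooth (t i), ?_⟩
    filter_upwards [ht] with x hx
    refine ⟨hx.1.map' _ (LinearMap.ker_eq_bot.2 (hnd.injective x)), ?_⟩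
    rw [LinearMap.range_eq_map, ← hx.2, Submodule.map_span, ← Set.range_comp]
    rfl
  lagrangian x p := by
    refine mem_iff_pairing_eq_zero ?_ ?_ p
    · rw [LinearMap.finrank_range_of_inj (hnd.injective x)]
      exact (hnd x).1
    · rintro _ ⟨e, rfl⟩ _ ⟨f, rfl⟩
      exact hIM.pairing_eq_zero x e f
  involutive X Y α β hα hβ hX hY x := by
    -- Lifting both sections to `E` reduces involutivity to closure of sections of `E` under the
    -- algebroid bracket.
    obtain ⟨s, hs1, hs2⟩ := exists_sec_of_mem_range hnd.injective hα hX
    obtain ⟨t, ht1, ht2⟩ := exists_sec_of_mem_range hnd.injective hβ hY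
    have h := hIM.prod_bracket hχ s t x
    rw [hs2, ht2, funext hs1, funext ht1] at h
    exact ⟨A.bracket s t x, h⟩

end Dirac

/-! ### Uniqueness of quotients and the reduced Dirac structure -/

section Quotient

variable {B : Type*} [NormedAddCommGroup B] [NormedSpace ℝ B] [FiniteDimensional ℝ B]
  {M : Type*} [TopologicalSpace M] [ChartedSpace B M] [IsManifold 𝓘(ℝ, B) ∞ M]
  {F : Type*} [NormedAddCommGroup F] [NormedSpace ℝ F]
  {E : M → Type*} [TopologicalSpace (TotalSpace F E)] [∀ x, AddCommGroup (E x)]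
  [∀ x, Module ℝ (E x)] [∀ x, TopologicalSpace (E x)] [FiberBundle F E] [VectorBundle ℝ F E]
  {B' : Type*} [NormedAddCommGroup B'] [NormedSpace ℝ B'] [FiniteDimensional ℝ B']
  {M' : Type*} [TopologicalSpace M'] [ChartedSpace B' M'] [IsManifold 𝓘(ℝ, B') ∞ M']
  {F' : Type*} [NormedAddCommGroup F'] [NormedSpace ℝ F']
  {E' : M' → Type*} [TopologicalSpace (TotalSpace F' E')] [∀ y, AddCommGroup (E' y)]
  [∀ y, Module ℝ (E' y)] [∀ y, TopologicalSpace (E' y)] [FiberBundle F' E']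
  [VectorBundle ℝ F' E']
  {A : LieAlgebroid B F E} {A' : LieAlgebroid B' F' E'} {q : SimpleQuotient B F E B' F' E'}

theorem IsClosedForm.pullForm {k : ℕ} {f : M → M'} (hf : ContMDiff 𝓘(ℝ, B) 𝓘(ℝ, B') ∞ f)
    {w : ∀ y : M', Alt B' k y} (hw : IsClosedForm w) :
    IsClosedForm (AlgebroidQuotient.pullForm (B := B) f w) := by
  have hs := isSmoothForm_iff.1 hw.1
  refine ⟨isSmoothForm_iff.2 fun x => (hs (f x)).pullForm (hf x), fun x => ?_⟩
  rw [extD_pullForm (hf x) (hs (f x)), hw.2, map_zero]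

/-- The map `η_χ : e ↦ -i_{ρ(e)} χ`. -/
noncomputable def LieAlgebroid.twistMap (A : LieAlgebroid B F E) (χ : ∀ x : M, Alt B 3 x) (x : M) :
    E x →ₗ[ℝ] Alt B 2 x where
  toFun e := -contract (A.anchor x e) (χ x)
  map_add' e f := by rw [map_add, contract_add_left, neg_add]
  map_smul' c e := by rw [map_smul, contract_smul_left, RingHom.id_apply, smul_neg]

theorem SimpleQuotient.IsPushforward.unique {k : ℕ} {μ : FormMap B F E k}
    {μ₁ μ₂ : FormMap B' F' E' k} (h₁ : q.IsPushforward μ μ₁) (h₂ : q.IsPushforward μ μ₂) :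
    μ₁ = μ₂ := by
  have h : μ₁.toLin = μ₂.toLin := by
    funext y
    obtain ⟨x, rfl⟩ := q.base_surjective y
    ext1 e'
    obtain ⟨e, rfl⟩ := q.map_surjective x e'
    exact pullAt_injective (q.base_submersion x) k ((h₁ x e).trans (h₂ x e).symm)
  cases μ₁
  cases μ₂
  cases h
  rfl

/-- Injectivity of pullback forces the covector `β` of a reduced element to be `μ' (q e)`. -/
theorem SimpleQuotient.IsPushforward.mem_range_iff_memReduced {μ : FormMap B F E 1}
    {μ' : FormMap B' F' E' 1} (hq : q.IsAlgebroidMorphism A A') (hμ : q.IsPushforward μ μ')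
    (y : M') (p : TangentSpace 𝓘(ℝ, B') y × Alt B' 1 y) :
    p ∈ LinearMap.range ((A'.anchor y).prod (μ'.toLin y)) ↔ q.MemReduced A μ y p := by
  constructor
  · rintro ⟨e', rfl⟩
    obtain ⟨x, rfl⟩ := q.base_surjective y
    obtain ⟨e, rfl⟩ := q.map_surjective x e'
    have h := SimpleQuotient.MemReduced.mk (q := q) (A := A) x e _ (hμ x e)
    rw [← hq.anchor] at h
    exact h
  · rintro ⟨x, e, β, h⟩
    refine ⟨q.map x e, Prod.ext (hq.anchor x e) ?_⟩
    exact pullAt_injective (q.base_submersion x) 1 ((hμ x e).trans h.symm)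

end Quotient

end AlgebroidQuotient

theorem mainTheorem11
    {B : Type*} [NormedAddCommGroup B] [NormedSpace ℝ B] [FiniteDimensional ℝ B]
    {M : Type*} [TopologicalSpace M] [T2Space M] [SecondCountableTopology M]
    [ChartedSpace B M] [IsManifold 𝓘(ℝ, B) ∞ M]
    {F : Type*} [NormedAddCommGroup F] [NormedSpace ℝ F] [FiniteDimensional ℝ F]
    {E : M → Type*} [TopologicalSpace (TotalSpace F E)] [∀ x, AddCommGroup (E x)]
    [∀ x, Module ℝ (E x)] [∀ x, TopologicalSpace (E x)] [FiberBundle F E] [VectorBundle ℝ F E]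
    [ContMDiffVectorBundle ∞ F E 𝓘(ℝ, B)]
    {B' : Type*} [NormedAddCommGroup B'] [NormedSpace ℝ B'] [FiniteDimensional ℝ B']
    {M' : Type*} [TopologicalSpace M'] [T2Space M'] [SecondCountableTopology M']
    [ChartedSpace B' M'] [IsManifold 𝓘(ℝ, B') ∞ M']
    {F' : Type*} [NormedAddCommGroup F'] [NormedSpace ℝ F'] [FiniteDimensional ℝ F']
    {E' : M' → Type*} [TopologicalSpace (TotalSpace F' E')] [∀ y, AddCommGroup (E' y)]
    [∀ y, Module ℝ (E' y)] [∀ y, TopologicalSpace (E' y)] [FiberBundle F' E']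
    [VectorBundle ℝ F' E'] [ContMDiffVectorBundle ∞ F' E' 𝓘(ℝ, B')]
    (A : LieAlgebroid B F E) (A' : LieAlgebroid B' F' E')
    (q : SimpleQuotient B F E B' F' E') (hq : q.IsAlgebroidMorphism A A')
    (μ : FormMap B F E 1) (η : FormMap B F E 2) (hIM : IsIM A μ η) :
    (IsDiracQuotientData q A A' μ η ↔
      (∃ χ' : ∀ y : M', Alt B' 3 y, IsClosedForm χ' ∧ IsTwistedBy A η (pullForm q.base χ')) ∧
      ((∀ x, q.K x = LinearMap.ker (μ.toLin x) ⊓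
          (LinearMap.ker (mfderiv 𝓘(ℝ, B) 𝓘(ℝ, B') q.base x).toLinearMap).comap (A.anchor x)) ∧
        ∀ x, (Module.finrank ℝ (q.K x) : ℤ) = Module.finrank ℝ (E x) - Module.finrank ℝ B') ∧
      (∃ (hK : ∀ x, q.K x ≤ LinearMap.ker (μ.toLin x))
        (hAnn : ∀ x (e : E x), μ.toLin x e ∈ q.ann x),
        ∀ (x y : M) (h : q.base x = q.base y) (e : E y ⧸ q.K y),
          q.muBar μ hK hAnn x (q.Δ x y h e) = q.conormalΔ x y h (q.muBar μ hK hAnn y e))) ∧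
    (IsDiracQuotientData q A A' μ η →
      ∀ χ' : ∀ y : M', Alt B' 3 y, IsClosedForm χ' →
        IsTwistedBy A η (pullForm q.base χ') →
        ∃ L' : ∀ y : M', Submodule ℝ (TangentSpace 𝓘(ℝ, B') y × Alt B' 1 y),
          (∀ y p, p ∈ L' y ↔ q.MemReduced A μ y p) ∧
          IsDirac χ' L' ∧
          ∀ (μ' : FormMap B' F' E' 1) (η' : FormMap B' F' E' 2),
            q.IsPushforward μ μ' → q.IsPushforward η η' →
            IsTwistedBy A' η' χ' ∧
            (∀ y, Function.Injective ((A'.anchor y).prod (μ'.toLin y)) ∧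
              LinearMap.range ((A'.anchor y).prod (μ'.toLin y)) = L' y) ∧
            ∀ (s t : Sec B' F' E') (y : M'),
              (A'.anchorSec (A'.bracket s t) y, μ'.onSec (A'.bracket s t) y) =
                courant χ' (A'.anchorSec s) (μ'.onSec s) (A'.anchorSec t) (μ'.onSec t) y) := by
  refine ⟨⟨fun h => ?_, ?_⟩, fun h χ' hχ' htw => ?_⟩
  · obtain ⟨μ', η', hμ, hη, -, ⟨χ', hχ', htw⟩, hnd⟩ := h.quotient
    refine ⟨⟨χ', hχ', htw.pullForm hq hη⟩, (hμ.isWeaklyNondegenerate_iff hq).1 hnd, hμ.K_le_ker,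
      fun x e => ?_, hμ.equivariant _ _⟩
    rw [← hμ]
    exact q.pullAt_mem_ann x _
  · rintro ⟨⟨χ', hχ', htw⟩, hK, hKer, hAnn, heq⟩
    obtain ⟨μ', hμ⟩ := SimpleQuotient.exists_isPushforward_of_equivariant hKer hAnn heq
    -- Unlike `μ'`, `η'` needs no equivariance hypothesis: it is `η_χ'`, and its compatibility with
    -- `η` is condition 1 combined with that of the anchors.
    obtain ⟨η', -, hη⟩ := SimpleQuotient.exists_isPushforward_of_linearMap (q := q) (μ := η)
      (A'.twistMap χ') (fun x e => by
        rw [htw, pullForm, contract_pullAt, ← hq.anchor, ← map_neg]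
        rfl)
    refine ⟨hIM, ⟨pullForm q.base χ', hχ'.pullForm q.base_smooth, htw⟩,
      ⟨hμ.K_le_ker, hη.K_le_ker, fun s => hμ.isBasicForm, fun s => hη.isBasicForm⟩,
      μ', η', hμ, hη, hIM.of_isPushforward hq hμ hη, ⟨χ', hχ', htw.of_pullForm hq hη⟩,
      (hμ.isWeaklyNondegenerate_iff hq).2 hK⟩
  · obtain ⟨μ', η', hμ, hη, hIM', -, hnd⟩ := h.quotient
    -- The given `χ'` may differ from the twisting form contained in `h`; it twists `η'` because `q`
    -- is surjective and pullback injective.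
    have htw' := htw.of_pullForm hq hη
    refine ⟨fun y => LinearMap.range ((A'.anchor y).prod (μ'.toLin y)), fun y p => ?_,
      hIM'.isDirac_range htw' hnd, fun μ₁ η₁ hμ₁ hη₁ => ?_⟩
    · exact hμ.mem_range_iff_memReduced hq y p
    -- Quotients are unique, so an arbitrary pair `(μ₁, η₁)` is the one used to build `L'`.
    · obtain rfl := hμ.unique hμ₁
      obtain rfl := hη.unique hη₁
      exact ⟨htw', fun y => ⟨hnd.injective y, rfl⟩, hIM'.prod_bracket htw'⟩
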